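/- Let $k$ be an algebraically closed field (of arbitrary characteristic), let $S=k[X_1,\dots,X_n]$ be a standard graded polynomial ring, and let $I\subseteq S$ be a proper graded ideal. Suppose that $I$ satisfies at least one of the following two conditions. (a) The nonzero graded Betti numbers $\beta_{i,j}=\dim_k \operatorname{Tor}_i^S(S/I,k)_j$ of $S/I$ are exactly $\beta_{0,0}=1$, $\beta_{1,2}=4$, $\beta_{2,3}=3$, $\beta_{2,4}=1$, $\beta_{3,5}=1$; that is, the minimal graded free resolution has the form $$0\to S(-5)\to S(-3)^3\oplus S(-4)\to S(-2)^4\to S\to S/I\to 0 .$$ (b) $I=(xz,\;yz,\;a_3x+b_3y,\;a_4x+b_4y)$ for some linear forms $x,y,z,a_3,a_4,b_3,b_4\in S$ such that $\operatorname{ht}(x,y)=\operatorname{ht}(a_3x+b_3y,\,a_4x+b_4y)=2$ and $\operatorname{ht}(z,\;a_3x+b_3y,\;a_4x+b_4y,\;a_3b_4-a_4b_3)=3$. Then $R=S/I$ is LG-quadratic: there are a polynomial ring $\tilde S=k[Y_1,\dots,Y_N]$, an ideal $J\subseteq\tilde S$ such that, for some linear change of coordinates $\varphi$ of $\tilde S$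 and some monomial order, $\varphi(J)$ has a Gröbner basis consisting of quadrics, and a sequence $\ell_1,\dots,\ell_c$ of linear forms of $\tilde S$ that is a regular sequence on $\tilde S/J$, such that $R\cong \tilde S/(J,\ell_1,\dots,\ell_c)$ as graded $k$-algebras. -/

import Mathlib

open MvPolynomial

/-- A minimal graded free resolution
`⋯ → F₂ → F₁ → F₀ → S/I → 0` of `S/I`, where `S = k[X₀, …, Xₙ₋₁]` has the standard grading.
The free module `Fᵢ = ⨁ₐ S(-deg i a)` has a basis of `rank i` homogeneous elements, of degrees
`deg i a`; the map `Fᵢ₊₁ → Fᵢ` is given by the matrix `d i` and the map `F₀ → S/I` by the row of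
the classes of `gen a`; all maps are homogeneous of degree `0`. -/
structure MinimalGradedFreeResolution {k : Type*} [Field k] {n : ℕ}
    (I : Ideal (MvPolynomial (Fin n) k)) where
  rank : ℕ → ℕ
  deg : ∀ i, Fin (rank i) → ℕ
  gen : Fin (rank 0) → MvPolynomial (Fin n) k
  d : ∀ i, Matrix (Fin (rank i)) (Fin (rank (i + 1))) (MvPolynomial (Fin n) k)
  gen_homogeneous : ∀ a, (gen a).IsHomogeneous (deg 0 a)
  /-- A nonzero entry is a form of degree equal to the difference of the two degrees. -/
  d_homogeneous : ∀ i a b, d i a b ≠ 0 →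
    deg i a ≤ deg (i + 1) b ∧ (d i a b).IsHomogeneous (deg (i + 1) b - deg i a)
  /-- `F₀ → S/I` is surjective. -/
  surjective : Ideal.span (Set.range gen) ⊔ I = ⊤
  /-- Exactness at `F₀`. -/
  exact_zero : ∀ v : Fin (rank 0) → MvPolynomial (Fin n) k,
    ∑ a, v a * gen a ∈ I ↔ ∃ w, (d 0).mulVec w = v
  /-- Exactness at `Fᵢ₊₁`. -/
  exact_succ : ∀ i, ∀ v : Fin (rank (i + 1)) → MvPolynomial (Fin n) k,
    (d i).mulVec v = 0 ↔ ∃ w, (d (i + 1)).mulVec w = v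
  /-- Minimality: all entries lie in the ideal `(X₀, …, Xₙ₋₁)`. -/
  minimal : ∀ i a b, constantCoeff (d i a b) = 0

/-- The number of basis elements of degree `j` of the `i`-th free module: this is
`dim Tor_i(S/I, k)_j`, as the differentials vanish after tensoring with `k`. -/
def MinimalGradedFreeResolution.betti {k : Type*} [Field k] {n : ℕ}
    {I : Ideal (MvPolynomial (Fin n) k)} (F : MinimalGradedFreeResolution I) (i j : ℕ) : ℕ :=
  Fintype.card {a : Fin (F.rank i) // F.deg i a = j}

/-- The graded Betti numbers `β_{i,j}` of `S/I` over `S` (with `j` the internal degree) are given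
by `β`. The minimal graded free resolution is unique up to isomorphism, so any one may be used. -/
def HasGradedBettiNumbers {k : Type*} [Field k] {n : ℕ}
    (I : Ideal (MvPolynomial (Fin n) k)) (β : ℕ → ℕ → ℕ) : Prop :=
  ∃ F : MinimalGradedFreeResolution I, ∀ i j, F.betti i j = β i j

/-- The graded Betti numbers, indexed by homological degree `i` and internal degree `j`, of the
table with row `0` equal to `1 - - -`, row `1` equal to `- 4 3 -` and row `2` equal to `- - 1 1`
(column `i` and row `r` hold the value at `(i, i + r)`). -/
def bettiTableIII : ℕ → ℕ → ℕ
  | 0, 0 => 1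
  | 1, 2 => 4
  | 2, 3 => 3
  | 2, 4 => 1
  | 3, 5 => 1
  | _, _ => 0

/-- `I = (xz, yz, a₃x + b₃y, a₄x + b₄y)` for linear forms with `ht (x, y) = 2`,
`ht (a₃x + b₃y, a₄x + b₄y) = 2` and
`ht (z, a₃x + b₃y, a₄x + b₄y, a₃b₄ - a₄b₃) = 3`. -/
def HasFormIII {k : Type*} [Field k] {n : ℕ} (I : Ideal (MvPolynomial (Fin n) k)) : Prop :=
  ∃ x y z a₃ a₄ b₃ b₄ : MvPolynomial (Fin n) k,
    x.IsHomogeneous 1 ∧ y.IsHomogeneous 1 ∧ z.IsHomogeneous 1 ∧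
    a₃.IsHomogeneous 1 ∧ a₄.IsHomogeneous 1 ∧ b₃.IsHomogeneous 1 ∧ b₄.IsHomogeneous 1 ∧
    I = Ideal.span {x * z, y * z, a₃ * x + b₃ * y, a₄ * x + b₄ * y} ∧
    (Ideal.span {x, y}).height = 2 ∧
    (Ideal.span {a₃ * x + b₃ * y, a₄ * x + b₄ * y}).height = 2 ∧
    (Ideal.span {z, a₃ * x + b₃ * y, a₄ * x + b₄ * y, a₃ * b₄ - a₄ * b₃}).height = 3

/-- `G` is a Gröbner basis of `J` with respect to the monomial order `m`. -/
def IsGroebnerBasis {k : Type*} [Field k] {n : ℕ} (m : MonomialOrder.{0, 0} (Fin n))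
    (G : Finset (MvPolynomial (Fin n) k)) (J : Ideal (MvPolynomial (Fin n) k)) : Prop :=
  (G : Set (MvPolynomial (Fin n) k)) ⊆ J ∧
    Ideal.span (m.leadingTerm '' (G : Set (MvPolynomial (Fin n) k))) =
      Ideal.span (m.leadingTerm '' (J : Set (MvPolynomial (Fin n) k)))

/-- After some linear change of coordinates `φ`, the ideal `φ(I)` has, for some monomial order, a
Gröbner basis consisting of quadrics. -/
def IsGQuadratic {k : Type*} [Field k] {n : ℕ} (I : Ideal (MvPolynomial (Fin n) k)) : Prop :=
  ∃ φ : MvPolynomial (Fin n) k ≃ₐ[k] MvPolynomial (Fin n) k,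
    (∀ i, (φ (X i)).IsHomogeneous 1) ∧
    ∃ (m : MonomialOrder.{0, 0} (Fin n)) (G : Finset (MvPolynomial (Fin n) k)),
      (∀ g ∈ G, g.IsHomogeneous 2) ∧ IsGroebnerBasis m G (I.map φ)

/-- `S/I` is, as a graded algebra, the quotient of a G-quadratic algebra
`A = k[X₀, …, X_{N-1}]/J` by an `A`-regular sequence (the classes of the list `L`) of linear forms.
An isomorphism between such quotients that sends the classes of the variables to classes of linear
forms is an isomorphism of graded algebras, as both sides are generated in degree one. -/
def IsLGQuadratic {k : Type*} [Field k] {n : ℕ} (I : Ideal (MvPolynomial (Fin n) k)) : Prop :=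
  ∃ (N : ℕ) (J : Ideal (MvPolynomial (Fin N) k)) (L : List (MvPolynomial (Fin N) k)),
    IsGQuadratic J ∧ (∀ l ∈ L, l.IsHomogeneous 1) ∧
    RingTheory.Sequence.IsRegular (MvPolynomial (Fin N) k ⧸ J) L ∧
    ∃ e : (MvPolynomial (Fin n) k ⧸ I) ≃ₐ[k] (MvPolynomial (Fin N) k ⧸ (J ⊔ Ideal.ofList L)),
      ∀ i, ∃ l : MvPolynomial (Fin N) k, l.IsHomogeneous 1 ∧
        e (Ideal.Quotient.mk I (X i)) = Ideal.Quotient.mk (J ⊔ Ideal.ofList L) l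

-- In both cases `I = z(x, y) + (f, g)` with linear forms `x, y, z` and quadrics `f = ax + by`, `g =
-- cx + dy` in `(x, y)`. Adjoin seven variables `Y` to `S` and add one of them to each of `a, d, x,
-- y, z, -b, -c`. The resulting ideal `J` specializes to `I` at `Y = 0`; after a linear change of
-- coordinates it is the ideal of the four quadrics with independent variables as entries, which are
-- a lex Gröbner basis (`isGroebnerBasis_genericQuadrics`). What remains is that `Y` is a regular
-- sequence modulo `J`.
--
-- The criterion is `LinkedMod`: `x, y` and `f, g` are regular sequences and `z` is a nonzerodivisor
-- on `(x, y)/(f, g)`. Then `I/(f, g)` is a shifted copy of `(x, y)/(f, g)`, so that `S/I` is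
-- assembled from complete intersections. These conditions hold for the shifted forms modulo `Y`;
-- graded Nakayama lifts them along the `Y` one at a time, and each `Y` turns out to be regular on
-- the way (`LinkedMod.lift`).
--
-- Case (b): by Cramer's rule `ad - bc` multiplies `(x, y)` into `(f, g)`, so an element of `(x, y)`
-- killed by `z` modulo `(f, g)` is killed by `(z, ad - bc)`, and the height three condition forces
-- it into `(f, g)` (`mem_span_pair_of_height_eq_three`). If `z = 0`, then `I = (f, g)` and the
-- complete intersection alone is lifted.
--
-- Case (a): let `D` be the matrix of linear syzygies, `κ` the quadratic syzygy and `(u, z)` the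
-- last map. By exactness `(u, z)` behaves as an ideal of grade three (`mem_of_forall_mul_mem`).
-- Modulo `z` the rows of `D` are orthogonal to `u`, so their cross products are scalar multiples of
-- `u`, and the rows span a space of dimension at most two (`exists_rows_mem_span`). Hence two rows
-- of `D` can be made divisible by `z`, and a column change brings them to `(0, z, 0)` and `(0, 0,
-- z)`. The columns then exhibit the quadrics as `xz, yz, f, g`, the Koszul syzygy of `f, g` can
-- replace `κ`, and `LinkedMod` is read off from the syzygies.

attribute [local instance] MvPolynomial.gradedAlgebra

/-- Homogeneity of an ideal for the standard grading. -/
abbrev IsGraded {σ k : Type*} [Field k] (K : Ideal (MvPolynomial σ k)) : Prop :=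
  K.IsHomogeneous (homogeneousSubmodule σ k)

/-! ### Homogeneous components and graded Nakayama -/

section Graded

variable {σ k : Type*} [Field k]

lemma homogeneousComponent_mul_add {p q : MvPolynomial σ k} {d : ℕ} (hp : p.IsHomogeneous d)
    (n : ℕ) : homogeneousComponent (d + n) (p * q) = p * homogeneousComponent n q := by
  have := DirectSum.coe_decompose_mul_add_of_left_mem (homogeneousSubmodule σ k)
    (i := d) (j := n) (a := p) (b := q) hp
  simp only [← decomposition.decompose'_apply]
  exact this

lemma homogeneousComponent_mul_of_lt {p q : MvPolynomial σ k} {d n : ℕ} (hp : p.IsHomogeneous d)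
    (h : n < d) : homogeneousComponent n (p * q) = 0 := by
  have := DirectSum.coe_decompose_mul_of_left_mem_of_not_le (homogeneousSubmodule σ k)
    (n := n) (i := d) (a := p) (b := q) hp (by omega)
  simp only [← decomposition.decompose'_apply]
  exact this

lemma isGraded_span {s : Set (MvPolynomial σ k)} (h : ∀ p ∈ s, ∃ d, p.IsHomogeneous d) :
    IsGraded (Ideal.span s) :=
  Ideal.homogeneous_span _ _ h

lemma IsGraded.sup_span {K : Ideal (MvPolynomial σ k)} (hK : IsGraded K)
    {s : Set (MvPolynomial σ k)} (h : ∀ p ∈ s, ∃ d, p.IsHomogeneous d) :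
    IsGraded (K ⊔ Ideal.span s) :=
  Ideal.IsHomogeneous.sup hK (isGraded_span h)

lemma mem_of_homogeneousComponent_mem {K : Ideal (MvPolynomial σ k)} {p : MvPolynomial σ k}
    (h : ∀ n, homogeneousComponent n p ∈ K) : p ∈ K := by
  rw [← sum_homogeneousComponent p]
  exact sum_mem fun n _ => h n

/-- Graded Nakayama: a set which lies in `D + Y T` for a linear
form `Y` lies in `D`. -/
lemma graded_nakayama {T : Set (MvPolynomial σ k)} {D : Ideal (MvPolynomial σ k)}
    {Y : MvPolynomial σ k} (hY : Y.IsHomogeneous 1) (hD : IsGraded D)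
    (h : ∀ t ∈ T, ∃ r ∈ T, t - Y * r ∈ D) : ∀ t ∈ T, t ∈ D := by
  -- The induction runs over all of `T` at once: the component of `t` of degree `n + 1` is
  -- controlled by that of `r` of degree `n`. So `T` need not consist of homogeneous elements.
  have key : ∀ n, ∀ t ∈ T, homogeneousComponent n t ∈ D := by
    intro n
    induction n with
    | zero =>
      intro t ht
      obtain ⟨r, hr, hd⟩ := h t ht
      have := homogeneousComponent_mem_of_mem hD hd 0
      rwa [map_sub, homogeneousComponent_mul_of_lt hY (by omega), sub_zero] at this
    | succ n ih =>
      intro t ht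
      obtain ⟨r, hr, hd⟩ := h t ht
      have := homogeneousComponent_mem_of_mem hD hd (n + 1)
      rw [map_sub, add_comm n 1, homogeneousComponent_mul_add hY] at this
      rw [add_comm n 1]
      simpa using add_mem this (D.mul_mem_left Y (ih r hr))
  exact fun t ht => mem_of_homogeneousComponent_mem fun n => key n t ht

end Graded

/-! ### Regular sequences modulo an ideal, in terms of elements -/

section RegularMod

variable {R : Type*} [CommRing R]

/-- `f` is a nonzerodivisor modulo `K`. -/
def RegularMod (K : Ideal R) (f : R) : Prop := ∀ s, f * s ∈ K → s ∈ K

/-- `f, g` is a regular sequence modulo `K` (possibly with zero quotient). -/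
def PairRegularMod (K : Ideal R) (f g : R) : Prop :=
  RegularMod K f ∧ RegularMod (K ⊔ Ideal.span {f}) g

/-- The list is a regular sequence modulo `K` (possibly with zero quotient). -/
def ListRegularMod : Ideal R → List R → Prop
  | _, [] => True
  | K, r :: L => RegularMod K r ∧ ListRegularMod (K ⊔ Ideal.span {r}) L

lemma sup_span_pair (K : Ideal R) (f g : R) :
    K ⊔ Ideal.span {f} ⊔ Ideal.span {g} = K ⊔ Ideal.span {f, g} := by
  rw [sup_assoc, ← Ideal.span_union]; rfl

lemma mem_sup_span_singleton {K : Ideal R} {f s : R} :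
    s ∈ K ⊔ Ideal.span {f} ↔ ∃ r, s - f * r ∈ K := by
  rw [Submodule.mem_sup]
  constructor
  · rintro ⟨a, ha, b, hb, rfl⟩
    obtain ⟨c, rfl⟩ := Ideal.mem_span_singleton'.1 hb
    exact ⟨c, by convert ha using 1; ring⟩
  · rintro ⟨r, hr⟩
    exact ⟨_, hr, _, Ideal.mem_span_singleton'.2 ⟨r, rfl⟩, by ring⟩

lemma mem_sup_span_pair {K : Ideal R} {f g s : R} :
    s ∈ K ⊔ Ideal.span {f, g} ↔ ∃ a b, s - (a * f + b * g) ∈ K := by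
  rw [Submodule.mem_sup]
  constructor
  · rintro ⟨c, hc, b, hb, rfl⟩
    obtain ⟨a, b, rfl⟩ := Ideal.mem_span_pair.1 hb
    exact ⟨a, b, by convert hc using 1; ring⟩
  · rintro ⟨a, b, hr⟩
    exact ⟨_, hr, _, Ideal.mem_span_pair.2 ⟨a, b, rfl⟩, by ring⟩

/-- The ideal of the four quadrics is `z(x, y) + (f, g)`; this is the form in which the linkage
condition applies. -/
lemma mem_sup_span_quadrics {K : Ideal R} {x y z f g s : R} :
    s ∈ K ⊔ Ideal.span {x * z, y * z, f, g} ↔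
      ∃ p ∈ Ideal.span {x, y}, s - z * p ∈ K ⊔ Ideal.span {f, g} := by
  have e : K ⊔ Ideal.span {x * z, y * z, f, g} =
      (K ⊔ Ideal.span {f, g}) ⊔ Ideal.span {x * z, y * z} := by
    rw [sup_assoc, ← Ideal.span_union]
    congr 2
    ext t
    simp only [Set.mem_insert_iff, Set.mem_singleton_iff, Set.mem_union]
    tauto
  rw [e, mem_sup_span_pair]
  constructor
  · rintro ⟨a, b, h⟩
    exact ⟨a * x + b * y, Ideal.mem_span_pair.2 ⟨a, b, rfl⟩, by convert h using 1; ring⟩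
  · rintro ⟨p, hp, h⟩
    obtain ⟨a, b, rfl⟩ := Ideal.mem_span_pair.1 hp
    exact ⟨a, b, by convert h using 1; ring⟩

lemma ListRegularMod.regularMod_take {L : List R} {K : Ideal R} (h : ListRegularMod K L) :
    ∀ i (hi : i < L.length), RegularMod (K ⊔ Ideal.ofList (L.take i)) L[i] := by
  induction L generalizing K with
  | nil => intro i hi; simp at hi
  | cons r L ih =>
    intro i hi
    cases i with
    | zero => simpa using h.1
    | succ i =>
      have := ih h.2 i (by simpa using hi)
      simpa [sup_assoc] using this

lemma ListRegularMod.isWeaklyRegular {L : List R} {K : Ideal R} (h : ListRegularMod K L) :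
    RingTheory.Sequence.IsWeaklyRegular (R ⧸ K) L := by
  refine ⟨fun i hi => ?_⟩
  have e : ∀ s : R, Ideal.Quotient.mk K s ∈
      (Ideal.ofList (L.take i) • ⊤ : Submodule R (R ⧸ K)) ↔ s ∈ K ⊔ Ideal.ofList (L.take i) := by
    intro s
    have : (Ideal.ofList (L.take i) • ⊤ : Submodule R (R ⧸ K)) =
        Submodule.map K.mkQ (Ideal.ofList (L.take i)) := by
      rw [← Submodule.range_mkQ K, ← Submodule.map_top, ← Submodule.map_smul'']
      congr 1
      simp
    rw [this]
    constructor
    · rintro ⟨t, ht, hts⟩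
      have := (Submodule.Quotient.eq K).1 hts
      rw [sup_comm]
      exact Submodule.mem_sup.2 ⟨t, ht, s - t, by simpa using neg_mem this, by ring⟩
    · intro hs
      obtain ⟨a, ha, b, hb, rfl⟩ := Submodule.mem_sup.1 hs
      refine ⟨b, hb, ?_⟩
      exact (Submodule.Quotient.eq K).2 (by simpa using neg_mem ha)
  rw [isSMulRegular_iff_right_eq_zero_of_smul]
  intro m hm
  obtain ⟨m, rfl⟩ := Submodule.Quotient.mk_surjective _ m
  obtain ⟨s, rfl⟩ := Ideal.Quotient.mk_surjective m
  rw [← Submodule.Quotient.mk_smul, Submodule.Quotient.mk_eq_zero] at hm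
  rw [Submodule.Quotient.mk_eq_zero, e]
  refine h.regularMod_take i hi s ?_
  rw [← e]
  exact hm

end RegularMod

/-! ### Lifting regularity and linkage along linear forms -/

section Lifting

variable {σ k : Type*} [Field k] {K : Ideal (MvPolynomial σ k)} {Y : MvPolynomial σ k}

/-- The exchange of a regular sequence `Y, f` into `f, Y`. If `f s ∈ K`, then `s = Y r` modulo `K`
and `r` has the same property, so Nakayama gives `s ∈ K`. -/
lemma RegularMod.lift {f : MvPolynomial σ k}
    (hY : Y.IsHomogeneous 1) (hK : IsGraded K) (hYK : RegularMod K Y)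
    (h : RegularMod (K ⊔ Ideal.span {Y}) f) :
    RegularMod K f ∧ RegularMod (K ⊔ Ideal.span {f}) Y := by
  have h1 : RegularMod K f := by
    refine graded_nakayama (T := {s | f * s ∈ K}) hY hK ?_
    intro s hs
    obtain ⟨r, hr⟩ := mem_sup_span_singleton.1 (h s (Submodule.mem_sup_left hs))
    refine ⟨r, hYK _ ?_, hr⟩
    have := sub_mem (show f * s ∈ K from hs) (K.mul_mem_left f hr)
    convert this using 1; ring
  refine ⟨h1, fun s hs => ?_⟩
  obtain ⟨r, hr⟩ := mem_sup_span_singleton.1 hs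
  have hr' : r ∈ K ⊔ Ideal.span {Y} := by
    refine h r (mem_sup_span_singleton.2 ⟨s, ?_⟩)
    simpa using neg_mem hr
  obtain ⟨r', hr'⟩ := mem_sup_span_singleton.1 hr'
  refine mem_sup_span_singleton.2 ⟨r', hYK _ ?_⟩
  have := add_mem hr (K.mul_mem_left f hr')
  convert this using 1; ring

lemma PairRegularMod.lift {f g : MvPolynomial σ k} {d : ℕ} (hf : f.IsHomogeneous d)
    (hY : Y.IsHomogeneous 1) (hK : IsGraded K) (hYK : RegularMod K Y)
    (h : PairRegularMod (K ⊔ Ideal.span {Y}) f g) :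
    PairRegularMod K f g ∧ RegularMod (K ⊔ Ideal.span {f, g}) Y := by
  obtain ⟨h1, h2⟩ := RegularMod.lift hY hK hYK h.1
  have hK' : IsGraded (K ⊔ Ideal.span {f}) := hK.sup_span (by simpa using ⟨d, hf⟩)
  have h3 := h.2
  rw [sup_right_comm] at h3
  obtain ⟨h4, h5⟩ := RegularMod.lift hY hK' h2 h3
  exact ⟨⟨h1, h4⟩, by rwa [sup_span_pair] at h5⟩

/-- The conditions modulo `K` that make the ideal `(xz, yz, f, g)` lift along regular
sequences. -/
structure LinkedMod {R : Type*} [CommRing R] (K : Ideal R) (x y z f g : R) : Prop where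
  linear : PairRegularMod K x y
  quadrics : PairRegularMod K f g
  link : ∀ p ∈ K ⊔ Ideal.span {x, y}, z * p ∈ K ⊔ Ideal.span {f, g} → p ∈ K ⊔ Ideal.span {f, g}

variable {x y z f g : MvPolynomial σ k}

/-- Suppose `Y s = z p` modulo `(f, g)` with `p ∈ (x, y)`. Modulo `Y` the linkage condition gives `p
= Y r` modulo `(f, g)`, with `r ∈ (x, y)` because `Y` is regular modulo `(x, y)`. Cancelling `Y`
modulo `(f, g)` yields `s = z r` modulo `(f, g)`, an element of the ideal of the quadrics. The case
`s = 0` feeds Nakayama to lift the linkage condition itself. -/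
lemma LinkedMod.lift (hx : x.IsHomogeneous 1)
    (hf : f.IsHomogeneous 2) (hg : g.IsHomogeneous 2)
    (hfm : f ∈ Ideal.span {x, y}) (hgm : g ∈ Ideal.span {x, y})
    (hY : Y.IsHomogeneous 1) (hK : IsGraded K) (hYK : RegularMod K Y)
    (h : LinkedMod (K ⊔ Ideal.span {Y}) x y z f g) :
    LinkedMod K x y z f g ∧ RegularMod (K ⊔ Ideal.span {x * z, y * z, f, g}) Y := by
  obtain ⟨hP, hPY⟩ := h.linear.lift hx hY hK hYK
  obtain ⟨hC, hCY⟩ := h.quadrics.lift hf hY hK hYK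
  have hCh : IsGraded (K ⊔ Ideal.span {f, g}) := hK.sup_span (by
    rintro p (rfl | rfl); exacts [⟨2, hf⟩, ⟨2, hg⟩])
  have hCP : K ⊔ Ideal.span {f, g} ≤ K ⊔ Ideal.span {x, y} :=
    sup_le_sup_left (Ideal.span_le.2 (by rintro p (rfl | rfl); exacts [hfm, hgm])) K
  have step : ∀ p ∈ K ⊔ Ideal.span {x, y}, ∀ s, z * p - Y * s ∈ K ⊔ Ideal.span {f, g} →
      ∃ r ∈ K ⊔ Ideal.span {x, y}, p - Y * r ∈ K ⊔ Ideal.span {f, g} := by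
    intro p hp s hs
    have hle := sup_le_sup_right (le_sup_left : K ≤ K ⊔ Ideal.span {Y}) (Ideal.span {x, y})
    have h1 : z * p ∈ K ⊔ Ideal.span {Y} ⊔ Ideal.span {f, g} := by
      rw [sup_right_comm]
      exact mem_sup_span_singleton.2 ⟨s, hs⟩
    have h2 := h.link p (hle hp) h1
    rw [sup_right_comm] at h2
    obtain ⟨r, hr⟩ := mem_sup_span_singleton.1 h2
    refine ⟨r, hPY _ ?_, hr⟩
    have := sub_mem hp (hCP hr)
    convert this using 1; ring
  refine ⟨⟨hP, hC, ?_⟩, ?_⟩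
  · have := graded_nakayama
      (T := {p | p ∈ K ⊔ Ideal.span {x, y} ∧ z * p ∈ K ⊔ Ideal.span {f, g}}) hY hCh ?_
    · exact fun p hp hzp => this p ⟨hp, hzp⟩
    · intro p hp
      obtain ⟨r, hr, hpr⟩ := step p hp.1 0 (by simpa using hp.2)
      refine ⟨r, ⟨hr, hCY _ ?_⟩, hpr⟩
      have := sub_mem hp.2 (Ideal.mul_mem_left _ z hpr)
      convert this using 1; ring
  · intro s hs
    obtain ⟨p, hp, hps⟩ := mem_sup_span_quadrics.1 hs
    obtain ⟨r, hr, hpr⟩ := step p (Submodule.mem_sup_right hp) s (by simpa using neg_mem hps)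
    have h6 : s - z * r ∈ K ⊔ Ideal.span {f, g} := by
      refine hCY _ ?_
      have := add_mem hps (Ideal.mul_mem_left _ z hpr)
      convert this using 1; ring
    have h7 : z * r ∈ K ⊔ Ideal.span {x * z, y * z, f, g} := by
      obtain ⟨a, b, hab⟩ := mem_sup_span_pair.1 hr
      refine mem_sup_span_quadrics.2 ⟨a * x + b * y, Ideal.mem_span_pair.2 ⟨a, b, rfl⟩, ?_⟩
      have := (le_sup_left : K ≤ K ⊔ Ideal.span {f, g}) (K.mul_mem_left z hab)
      convert this using 1; ring
    have h8 : K ⊔ Ideal.span {f, g} ≤ K ⊔ Ideal.span {x * z, y * z, f, g} :=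
      sup_le_sup_left (Ideal.span_mono (by
        rintro p (rfl | rfl) <;> simp)) K
    simpa using add_mem (h8 h6) h7

lemma LinkedMod.lift_list (hx : x.IsHomogeneous 1) (hf : f.IsHomogeneous 2) (hg : g.IsHomogeneous 2)
    (hfm : f ∈ Ideal.span {x, y}) (hgm : g ∈ Ideal.span {x, y})
    {L : List (MvPolynomial σ k)} (hL : ∀ l ∈ L, l.IsHomogeneous 1) (hK : IsGraded K)
    (hLK : ListRegularMod K L) (h : LinkedMod (K ⊔ Ideal.ofList L) x y z f g) :
    LinkedMod K x y z f g ∧ ListRegularMod (K ⊔ Ideal.span {x * z, y * z, f, g}) L := by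
  induction L generalizing K with
  | nil => exact ⟨by simpa using h, trivial⟩
  | cons Y L ih =>
    have hY := hL Y (by simp)
    rw [Ideal.ofList_cons, ← sup_assoc] at h
    obtain ⟨h1, h2⟩ := ih (fun l hl => hL l (by simp [hl]))
      (hK.sup_span (by simpa using ⟨1, hY⟩)) hLK.2 h
    obtain ⟨h3, h4⟩ := h1.lift hx hf hg hfm hgm hY hK hLK.1
    exact ⟨h3, h4, by rwa [sup_right_comm]⟩

lemma PairRegularMod.lift_list (hf : f.IsHomogeneous 2)
    {L : List (MvPolynomial σ k)} (hL : ∀ l ∈ L, l.IsHomogeneous 1) (hK : IsGraded K)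
    (hLK : ListRegularMod K L) (h : PairRegularMod (K ⊔ Ideal.ofList L) f g) :
    PairRegularMod K f g ∧ ListRegularMod (K ⊔ Ideal.span {f, g}) L := by
  induction L generalizing K with
  | nil => exact ⟨by simpa using h, trivial⟩
  | cons Y L ih =>
    have hY := hL Y (by simp)
    rw [Ideal.ofList_cons, ← sup_assoc] at h
    obtain ⟨h1, h2⟩ := ih (fun l hl => hL l (by simp [hl]))
      (hK.sup_span (by simpa using ⟨1, hY⟩)) hLK.2 h
    obtain ⟨h3, h4⟩ := h1.lift hf hY hK hLK.1
    exact ⟨h3, h4, by rwa [sup_right_comm]⟩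

end Lifting

/-! ### The Gröbner basis of the generic quadrics -/

section Groebner

variable {k : Type*} [Field k]

/-- If no nonzero element of `J` is reduced with respect to `G ⊆ J`, then `G` is a Gröbner
basis. -/
lemma isGroebnerBasis_of_reduced_eq_zero {N : ℕ} {m : MonomialOrder.{0, 0} (Fin N)}
    {G : Finset (MvPolynomial (Fin N) k)} {J : Ideal (MvPolynomial (Fin N) k)}
    (hGJ : ∀ g ∈ G, g ∈ J) (hG0 : ∀ g ∈ G, g ≠ 0)
    (h : ∀ r ∈ J, (∀ u ∈ r.support, ∀ g ∈ G, ¬ m.degree g ≤ u) → r = 0) :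
    IsGroebnerBasis m G J := by
  refine ⟨fun g hg => hGJ g hg, le_antisymm (Ideal.span_mono (Set.image_mono fun g hg => hGJ g hg))
    (Ideal.span_le.2 ?_)⟩
  rintro _ ⟨f, hf, rfl⟩
  by_cases hf0 : f = 0
  · simp [hf0]
  have hu : ∀ g ∈ (G : Set (MvPolynomial (Fin N) k)), IsUnit (m.leadingCoeff g) := fun g hg =>
    (m.leadingCoeff_ne_zero_iff.2 (hG0 g hg)).isUnit
  obtain ⟨c, r, hfr, hdeg, hred⟩ := m.div_set hu f
  have hsum : Finsupp.linearCombination (MvPolynomial (Fin N) k)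
      (fun b : (G : Set (MvPolynomial (Fin N) k)) => (b : MvPolynomial (Fin N) k)) c =
      ∑ b ∈ c.support, c b * b := by
    simp [Finsupp.linearCombination_apply, Finsupp.sum]
  have hr : r = 0 := by
    refine h r ?_ fun u hu g hg => hred u hu g hg
    have : r = f - ∑ b ∈ c.support, c b * (b : MvPolynomial (Fin N) k) := by
      rw [← hsum]; exact (sub_eq_of_eq_add' hfr).symm
    rw [this]
    exact J.sub_mem hf (J.sum_mem fun b _ => J.mul_mem_left _ (hGJ b b.2))
  rw [hr, add_zero, hsum] at hfr
  have hmem : m.degree f ∈ (∑ b ∈ c.support, c b * (b : MvPolynomial (Fin N) k)).support := by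
    rw [← hfr]; exact m.degree_mem_support hf0
  obtain ⟨b, -, hb⟩ := Finset.mem_biUnion.1 (support_sum hmem)
  have hcb : c b * (b : MvPolynomial (Fin N) k) ≠ 0 := by
    intro h0; simp [h0] at hb
  have hle := m.le_degree hb
  have hge := hdeg b
  rw [mul_comm] at hge
  -- The leading monomial of `f` occurs in the product `c b * b`, whose degree the division
  -- algorithm bounds by that of `f`; so the degrees agree and no cancellation is involved.
  have heq : m.degree f = m.degree (c b) + m.degree (b : MvPolynomial (Fin N) k) := by
    rw [← m.degree_mul (left_ne_zero_of_mul hcb) (right_ne_zero_of_mul hcb)]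
    exact m.toSyn.injective (le_antisymm hle hge)
  have hlt : m.leadingTerm f = monomial (m.degree (c b))
      (m.leadingCoeff f * (m.leadingCoeff (b : MvPolynomial (Fin N) k))⁻¹) *
        m.leadingTerm (b : MvPolynomial (Fin N) k) := by
    have := (hu b b.2).ne_zero
    rw [MonomialOrder.leadingTerm, MonomialOrder.leadingTerm, monomial_mul, heq,
      inv_mul_cancel_right₀ this]
  rw [SetLike.mem_coe, hlt]
  exact Ideal.mul_mem_left _ _ (Ideal.subset_span ⟨b, b.2, rfl⟩)

variable {N : ℕ}

/-- The exponents of a monomial after the substitution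
`X (v 0) ↦ X (v 5) X (v 3) / X (v 2)`, `X (v 1) ↦ X (v 6) X (v 2) / X (v 3)`. -/
noncomputable def substExponent (v : Fin 7 → Fin N) (u : Fin N →₀ ℕ) : Fin N → ℤ :=
  fun i => u i +
    u (v 0) * ((if i = v 5 then 1 else 0) + (if i = v 3 then 1 else 0)
      - (if i = v 2 then 1 else 0) - (if i = v 0 then 1 else 0)) +
    u (v 1) * ((if i = v 6 then 1 else 0) + (if i = v 2 then 1 else 0)
      - (if i = v 3 then 1 else 0) - (if i = v 1 then 1 else 0))

lemma substExponent_add (v : Fin 7 → Fin N) (u u' : Fin N →₀ ℕ) :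
    substExponent v (u + u') = substExponent v u + substExponent v u' := by
  funext i
  simp only [substExponent, Finsupp.add_apply, Pi.add_apply]
  push_cast
  ring

/-- Let `e₂ = u₂ - u₀ + u₁` and `e₃ = u₃ + u₀ - u₁` be the exponents at `v 2` and `v 3`. For reduced
`u` with `(u₂, u₃) ≠ 0` one recovers `u₀ = max(0, -e₂)` and `u₁ = max(0, -e₃)`. When `u₂ = u₃ = 0`
only the difference `u₁ - u₀` survives at these two places. -/
lemma substExponent_inj {v : Fin 7 → Fin N} (hv : Function.Injective v)
    {u u' : Fin N →₀ ℕ} (h : substExponent v u = substExponent v u')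
    (_h1 : u (v 2) ≠ 0 ∨ u (v 3) ≠ 0) (_h1' : u' (v 2) ≠ 0 ∨ u' (v 3) ≠ 0)
    (h2 : u (v 0) = 0 ∨ u (v 2) = 0) (h2' : u' (v 0) = 0 ∨ u' (v 2) = 0)
    (h3 : u (v 1) = 0 ∨ u (v 3) = 0) (h3' : u' (v 1) = 0 ∨ u' (v 3) = 0) : u = u' := by
  have e2 := congrFun h (v 2)
  have e3 := congrFun h (v 3)
  simp [substExponent, hv.eq_iff] at e2 e3
  have h0 : u (v 0) = u' (v 0) := by omega
  have h1u : u (v 1) = u' (v 1) := by omega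
  ext i
  have := congrFun h i
  simpa [substExponent, h0, h1u] using this

/-- The sum of the coefficients of the monomials with given exponents after substitution. -/
noncomputable def substCoeff (v : Fin 7 → Fin N) (e : Fin N → ℤ) :
    MvPolynomial (Fin N) k →ₗ[k] k :=
  (basisMonomials (Fin N) k).constr k fun u => if substExponent v u = e then 1 else 0

lemma substCoeff_monomial (v : Fin 7 → Fin N) (e : Fin N → ℤ) (u : Fin N →₀ ℕ) (c : k) :
    substCoeff v e (monomial u c) = if substExponent v u = e then c else 0 := by
  have h : (monomial u c : MvPolynomial (Fin N) k) = c • basisMonomials (Fin N) k u := by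
    simp [coe_basisMonomials, smul_monomial]
  rw [h, map_smul, substCoeff, Module.Basis.constr_basis]
  simp

lemma substCoeff_mul_eq_zero {v : Fin 7 → Fin N} {e : Fin N → ℤ}
    {q : MvPolynomial (Fin N) k} (h : ∀ u, substCoeff v e (monomial u (1 : k) * q) = 0)
    (p : MvPolynomial (Fin N) k) : substCoeff v e (p * q) = 0 := by
  induction p using MvPolynomial.induction_on' with
  | monomial u c =>
    have : (monomial u c : MvPolynomial (Fin N) k) = c • monomial u 1 := by simp [smul_monomial]
    rw [this, smul_mul_assoc, map_smul, h, smul_zero]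
  | add p q hp hq => rw [add_mul, map_add, hp, hq, add_zero]

lemma X_mul_X_eq_monomial (i j : Fin N) : (X i * X j : MvPolynomial (Fin N) k) =
    monomial (Finsupp.single i 1 + Finsupp.single j 1) 1 := by
  simp [X, monomial_mul]

/-- The generic quadrics, in the variables `a, c, x, y, z, b, d = v 0, …, v 6`. -/
noncomputable def genericQuadrics (k : Type*) [Field k] (v : Fin 7 → Fin N) : Fin 4 → MvPolynomial (Fin N) k :=
  ![X (v 0) * X (v 2) - X (v 5) * X (v 3), X (v 1) * X (v 3) - X (v 6) * X (v 2),
    X (v 2) * X (v 4), X (v 3) * X (v 4)]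

/-- The two terms of each binomial have equal exponents after the substitution, so their
coefficients cancel. A multiple of either monomial quadric has positive exponent at `v 4`, which the
substitution leaves unchanged. -/
lemma substCoeff_genericQuadrics {v : Fin 7 → Fin N} (hv : Function.Injective v)
    {e : Fin N → ℤ} (i : Fin 4) (he : 2 ≤ i → e (v 4) = 0) (p : MvPolynomial (Fin N) k) :
    substCoeff v e (p * genericQuadrics k v i) = 0 := by
  refine substCoeff_mul_eq_zero (fun u => ?_) p
  have key : ∀ i j, ∀ h : e (v 4) = 0, (i = v 4 ∨ j = v 4) →
      substCoeff v e (monomial u (1 : k) * (X i * X j)) = 0 := by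
    intro i j he h
    rw [X_mul_X_eq_monomial, monomial_mul, substCoeff_monomial, if_neg]
    intro h'
    have := congrFun h' (v 4)
    rw [he] at this
    rcases h with rfl | rfl <;> simp [substExponent, hv.eq_iff, Finsupp.single_apply] at this <;>
      split_ifs at this <;> omega
  have key' : ∀ i j i' j', substExponent v (Finsupp.single i 1 + Finsupp.single j 1 : Fin N →₀ ℕ) =
      substExponent v (Finsupp.single i' 1 + Finsupp.single j' 1) →
      substCoeff v e (monomial u (1 : k) * (X i * X j - X i' * X j')) = 0 := by
    intro i j i' j' h
    rw [X_mul_X_eq_monomial, X_mul_X_eq_monomial, mul_sub, monomial_mul, monomial_mul, map_sub,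
      substCoeff_monomial, substCoeff_monomial, substExponent_add, substExponent_add v u, h, sub_self]
  fin_cases i
  · refine key' _ _ _ _ (funext fun i => ?_)
    simp [substExponent, hv.eq_iff, Finsupp.single_apply, eq_comm (a := i)]
    ring
  · refine key' _ _ _ _ (funext fun i => ?_)
    simp [substExponent, hv.eq_iff, Finsupp.single_apply, eq_comm (a := i)]
    ring
  · exact key _ _ (he le_rfl) (Or.inr rfl)
  · exact key _ _ (he (by decide)) (Or.inr rfl)

/-- The ideal lies in the monomial ideal `(X (v 2), X (v 3))`, so every monomial of `r` involves one
of these variables. Reduced monomials of this kind stay distinct under the substitution, so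
`substCoeff` isolates each coefficient of `r`, while it vanishes on the ideal. -/
lemma eq_zero_of_reduced {v : Fin 7 → Fin N} (hv : Function.Injective v) {s : Set (Fin 4)}
    {r : MvPolynomial (Fin N) k} (hr : r ∈ Ideal.span (genericQuadrics k v '' s))
    (h0 : ∀ u ∈ r.support, u (v 0) = 0 ∨ u (v 2) = 0)
    (h1 : ∀ u ∈ r.support, u (v 1) = 0 ∨ u (v 3) = 0)
    (h2 : (∃ i ∈ s, 2 ≤ i) → ∀ u ∈ r.support, u (v 2) ≠ 0 ∨ u (v 3) ≠ 0 → u (v 4) = 0) :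
    r = 0 := by
  have hxy : ∀ u ∈ r.support, u (v 2) ≠ 0 ∨ u (v 3) ≠ 0 := by
    have : Ideal.span (genericQuadrics k v '' s) ≤ Ideal.span (X '' {v 2, v 3}) := by
      rw [Ideal.span_le]
      have hx : (X (v 2) : MvPolynomial (Fin N) k) ∈ Ideal.span (X '' {v 2, v 3}) :=
        Ideal.subset_span ⟨_, by simp, rfl⟩
      have hy : (X (v 3) : MvPolynomial (Fin N) k) ∈ Ideal.span (X '' {v 2, v 3}) :=
        Ideal.subset_span ⟨_, by simp, rfl⟩
      rintro _ ⟨i, -, rfl⟩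
      fin_cases i
      · exact sub_mem (Ideal.mul_mem_left _ _ hx) (Ideal.mul_mem_left _ _ hy)
      · exact sub_mem (Ideal.mul_mem_left _ _ hy) (Ideal.mul_mem_left _ _ hx)
      · exact Ideal.mul_mem_right _ _ hx
      · exact Ideal.mul_mem_right _ _ hy
    intro u hu
    obtain ⟨i, hi, hui⟩ := mem_ideal_span_X_image.1 (this hr) u hu
    rcases hi with rfl | rfl
    exacts [Or.inl hui, Or.inr hui]
  ext u
  rw [coeff_zero]
  by_contra hu
  have hu : u ∈ r.support := mem_support_iff.2 hu
  have hL : substCoeff v (substExponent v u) r = 0 := by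
    rw [Ideal.span, Submodule.mem_span_image_iff_exists_fun] at hr
    obtain ⟨t, ht, c, rfl⟩ := hr
    rw [map_sum]
    refine Finset.sum_eq_zero fun i _ => substCoeff_genericQuadrics hv i (fun hi => ?_) _
    have := h2 ⟨i, ht i.2, hi⟩ u hu (hxy u hu)
    simp [substExponent, hv.eq_iff, this]
  rw [r.as_sum, map_sum] at hL
  rw [Finset.sum_eq_single_of_mem u hu] at hL
  · rw [substCoeff_monomial, if_pos rfl] at hL
    exact mem_support_iff.1 hu hL
  · intro u' hu' hne
    rw [substCoeff_monomial, if_neg]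
    intro h
    exact hne (substExponent_inj hv h (hxy u' hu') (hxy u hu) (h0 u' hu') (h0 u hu) (h1 u' hu')
      (h1 u hu))

lemma lex_single_lt {i j i' j' : Fin N} (hj : i < j) (hi' : i < i') (hj' : i < j') :
    MonomialOrder.lex.toSyn (Finsupp.single i' 1 + Finsupp.single j' 1 : Fin N →₀ ℕ) <
      MonomialOrder.lex.toSyn (Finsupp.single i 1 + Finsupp.single j 1 : Fin N →₀ ℕ) := by
  rw [MonomialOrder.lex_lt_iff, Finsupp.Lex.lt_iff]
  refine ⟨i, fun l hl => ?_, ?_⟩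
  · simp [hl.ne', (hl.trans hj).ne', (hl.trans hi').ne', (hl.trans hj').ne']
  · simp [hj.ne', hi'.ne', hj'.ne']

lemma degree_X_mul_X (m : MonomialOrder.{0, 0} (Fin N)) (i j : Fin N) :
    m.degree (X i * X j : MvPolynomial (Fin N) k) =
      Finsupp.single i 1 + Finsupp.single j 1 := by
  rw [m.degree_mul (X_ne_zero i) (X_ne_zero j), m.degree_X, m.degree_X]

lemma degree_binomial {i j i' j' : Fin N} (hj : i < j) (hi' : i < i') (hj' : i < j') :
    MonomialOrder.lex.degree (X i * X j - X i' * X j' : MvPolynomial (Fin N) k) =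
      Finsupp.single i 1 + Finsupp.single j 1 := by
  rw [MonomialOrder.degree_sub_of_lt, degree_X_mul_X]
  rw [degree_X_mul_X, degree_X_mul_X]
  exact lex_single_lt hj hi' hj'

lemma isHomogeneous_genericQuadrics (v : Fin 7 → Fin N) (i : Fin 4) :
    (genericQuadrics k v i).IsHomogeneous 2 := by
  have h : ∀ i j : Fin N, (X i * X j : MvPolynomial (Fin N) k).IsHomogeneous 2 := fun i j =>
    (isHomogeneous_X k i).mul (isHomogeneous_X k j)
  fin_cases i
  exacts [(h _ _).sub (h _ _), (h _ _).sub (h _ _), h _ _, h _ _]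

lemma single_add_single_le {i j : Fin N} (h : i ≠ j) {u : Fin N →₀ ℕ} :
    Finsupp.single i 1 + Finsupp.single j 1 ≤ u ↔ u i ≠ 0 ∧ u j ≠ 0 := by
  constructor
  · intro hu
    have h1 := hu i
    have h2 := hu j
    simp [h, h.symm] at h1 h2
    omega
  · rintro ⟨h1, h2⟩ l
    simp only [Finsupp.add_apply, Finsupp.single_apply]
    split_ifs with h3 h4 <;> simp_all <;> omega

/-- The degrees of the generic quadrics for the lexicographic order. -/
lemma degree_genericQuadrics {v : Fin 7 → Fin N} (hv : StrictMono v) (i : Fin 4) :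
    MonomialOrder.lex.degree (genericQuadrics k v i) =
      Finsupp.single (v (![0, 1, 2, 3] i)) 1 + Finsupp.single (v (![2, 3, 4, 4] i)) 1 := by
  have h : ∀ i j : Fin 7, i < j → v i < v j := fun i j h => hv h
  fin_cases i
  · exact degree_binomial (h _ _ (by decide)) (h _ _ (by decide)) (h _ _ (by decide))
  · exact degree_binomial (h _ _ (by decide)) (h _ _ (by decide)) (h _ _ (by decide))
  · exact degree_X_mul_X _ _ _
  · exact degree_X_mul_X _ _ _

-- The leading monomials are `v₀v₂`, `v₁v₃`, `v₂v₄`, `v₃v₄`. Two choices of `s` matter: all four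
-- quadrics, and the two binomials alone, which serve the case `z = 0`.
open Classical in
lemma isGroebnerBasis_genericQuadrics {v : Fin 7 → Fin N} (hv : StrictMono v) {s : Finset (Fin 4)}
    (h0 : 0 ∈ s) (h1 : 1 ∈ s) (h2 : ∀ i ∈ s, 2 ≤ i → 2 ∈ s ∧ 3 ∈ s) :
    IsGroebnerBasis MonomialOrder.lex (s.image (genericQuadrics k v))
      (Ideal.span (genericQuadrics k v '' s)) := by
  have hne : ∀ i, genericQuadrics k v i ≠ 0 := by
    intro i hi
    have := degree_genericQuadrics (k := k) hv i
    rw [hi, MonomialOrder.degree_zero] at this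
    have := DFunLike.congr_fun this (v (![0, 1, 2, 3] i))
    simp only [Finsupp.coe_zero, Pi.zero_apply, Finsupp.add_apply, Finsupp.single_eq_same] at this
    omega
  refine isGroebnerBasis_of_reduced_eq_zero (fun g hg => ?_) (fun g hg => ?_) (fun r hr hred => ?_)
  · obtain ⟨i, hi, rfl⟩ := Finset.mem_image.1 hg
    exact Ideal.subset_span ⟨i, hi, rfl⟩
  · obtain ⟨i, hi, rfl⟩ := Finset.mem_image.1 hg
    exact hne i
  · have key : ∀ u ∈ r.support, ∀ i ∈ s,
        u (v (![0, 1, 2, 3] i)) = 0 ∨ u (v (![2, 3, 4, 4] i)) = 0 := by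
      intro u hu i hi
      have := hred u hu _ (Finset.mem_image_of_mem _ hi)
      rw [degree_genericQuadrics hv, single_add_single_le] at this
      · tauto
      · exact hv.injective.ne (by fin_cases i <;> simp)
    refine eq_zero_of_reduced hv.injective hr (fun u hu => key u hu 0 h0)
      (fun u hu => key u hu 1 h1) ?_
    rintro ⟨i, hi, hi2⟩ u hu hxy
    have k2 := key u hu 2 (h2 i hi hi2).1
    have k3 := key u hu 3 (h2 i hi hi2).2
    simp at k2 k3
    tauto

end Groebner

/-! ### Generic deformation and specialization -/

section Assembly

variable {k : Type*} [Field k]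

lemma regularMod_X {σ : Type*} {A : Set σ} {i : σ} (hi : i ∉ A) :
    RegularMod (Ideal.span (X '' A)) (X i : MvPolynomial σ k) := by
  intro s hs
  rw [mem_ideal_span_X_image] at hs ⊢
  intro u hu
  obtain ⟨j, hj, hju⟩ := hs (Finsupp.single i 1 + u) (by
    rw [support_X_mul]; exact Finset.mem_map.2 ⟨u, hu, rfl⟩)
  refine ⟨j, hj, ?_⟩
  have : i ≠ j := fun h => hi (h ▸ hj)
  simpa [Finsupp.single_apply, this] using hju

lemma listRegularMod_X {σ : Type*} {A : Set σ} {l : List σ} (hl : l.Nodup)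
    (hA : ∀ i ∈ l, i ∉ A) :
    ListRegularMod (Ideal.span (X '' A)) (l.map (X : σ → MvPolynomial σ k)) := by
  induction l generalizing A with
  | nil => trivial
  | cons i l ih =>
    refine ⟨regularMod_X (hA i (by simp)), ?_⟩
    rw [← Ideal.span_union, ← Set.image_singleton, ← Set.image_union]
    refine ih (List.nodup_cons.1 hl).2 fun j hj hjA => ?_
    rcases hjA with h | h
    · exact hA j (by simp [hj]) h
    · rw [Set.mem_singleton_iff] at h
      exact (List.nodup_cons.1 hl).1 (h ▸ hj)

variable {n : ℕ}

/-- The inclusion of `k[X]` in `k[Y, X]`. -/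
noncomputable def inclX : MvPolynomial (Fin n) k →ₐ[k] MvPolynomial (Fin (7 + n)) k :=
  rename (Fin.natAdd 7)

/-- The specialization `Y = 0` from `k[Y, X]` to `k[X]`. -/
noncomputable def specY : MvPolynomial (Fin (7 + n)) k →ₐ[k] MvPolynomial (Fin n) k :=
  aeval (Fin.addCases (fun _ => 0) X)

/-- The endomorphism `Y ↦ Y + lam`, `X ↦ X` of `k[Y, X]`. -/
noncomputable def shiftY (lam : Fin 7 → MvPolynomial (Fin n) k) :
    MvPolynomial (Fin (7 + n)) k →ₐ[k] MvPolynomial (Fin (7 + n)) k :=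
  aeval (Fin.addCases (fun j => X (Fin.castAdd n j) + inclX (lam j)) (fun i => X (Fin.natAdd 7 i)))

@[simp] lemma inclX_X (i : Fin n) : inclX (X i : MvPolynomial (Fin n) k) = X (Fin.natAdd 7 i) := by
  simp [inclX]

@[simp] lemma specY_castAdd (j : Fin 7) :
    specY (X (Fin.castAdd n j) : MvPolynomial (Fin (7 + n)) k) = 0 := by
  simp [specY]

@[simp] lemma specY_natAdd (i : Fin n) :
    specY (X (Fin.natAdd 7 i) : MvPolynomial (Fin (7 + n)) k) = X i := by
  simp [specY]

@[simp] lemma shiftY_castAdd (lam : Fin 7 → MvPolynomial (Fin n) k) (j : Fin 7) :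
    shiftY lam (X (Fin.castAdd n j)) = X (Fin.castAdd n j) + inclX (lam j) := by
  simp [shiftY]

@[simp] lemma shiftY_natAdd (lam : Fin 7 → MvPolynomial (Fin n) k) (i : Fin n) :
    shiftY lam (X (Fin.natAdd 7 i)) = X (Fin.natAdd 7 i) := by
  simp [shiftY]

@[simp] lemma specY_inclX (p : MvPolynomial (Fin n) k) : specY (inclX p) = p := by
  have : (specY.comp inclX : MvPolynomial (Fin n) k →ₐ[k] _) = AlgHom.id k _ := by
    ext i; simp
  exact DFunLike.congr_fun this p

@[simp] lemma shiftY_inclX (lam : Fin 7 → MvPolynomial (Fin n) k) (p : MvPolynomial (Fin n) k) :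
    shiftY lam (inclX p) = inclX p := by
  have : (shiftY lam).comp inclX = inclX := by
    ext i; simp
  exact DFunLike.congr_fun this p

lemma algHom_ext_castAdd_natAdd {A : Type*} [CommRing A] [Algebra k A]
    {f g : MvPolynomial (Fin (7 + n)) k →ₐ[k] A}
    (h1 : ∀ j, f (X (Fin.castAdd n j)) = g (X (Fin.castAdd n j)))
    (h2 : ∀ i, f (X (Fin.natAdd 7 i)) = g (X (Fin.natAdd 7 i))) : f = g :=
  MvPolynomial.algHom_ext fun i => Fin.addCases h1 h2 i

/-- `Y ↦ Y + lam` as an automorphism. -/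
noncomputable def shiftYEquiv (lam : Fin 7 → MvPolynomial (Fin n) k) :
    MvPolynomial (Fin (7 + n)) k ≃ₐ[k] MvPolynomial (Fin (7 + n)) k :=
  AlgEquiv.ofAlgHom (shiftY lam) (shiftY (-lam))
    (algHom_ext_castAdd_natAdd (by simp) (by simp)) (algHom_ext_castAdd_natAdd (by simp) (by simp))

/-- The list of the variables `Y`. -/
noncomputable def listY (k : Type*) [Field k] (n : ℕ) : List (MvPolynomial (Fin (7 + n)) k) :=
  ((List.finRange 7).map (Fin.castAdd n)).map X

lemma mem_listY {p : MvPolynomial (Fin (7 + n)) k} :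
    p ∈ listY k n ↔ ∃ j, X (Fin.castAdd n j) = p := by
  simp [listY]

lemma ker_specY : RingHom.ker (specY (k := k) (n := n)) = Ideal.ofList (listY k n) := by
  refine le_antisymm (fun f hf => ?_) ?_
  · have : (Ideal.Quotient.mkₐ k (Ideal.ofList (listY k n))).comp (inclX.comp specY) =
        Ideal.Quotient.mkₐ k (Ideal.ofList (listY k n)) := by
      refine algHom_ext_castAdd_natAdd (fun j => ?_) (by simp)
      simp only [AlgHom.comp_apply, specY_castAdd, map_zero]
      have : X (Fin.castAdd n j) ∈ Ideal.ofList (listY k n) :=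
        Ideal.subset_span (mem_listY.2 ⟨j, rfl⟩)
      exact (Ideal.Quotient.eq_zero_iff_mem.2 this).symm
    have := DFunLike.congr_fun this f
    simp only [AlgHom.comp_apply, RingHom.mem_ker.1 hf, map_zero] at this
    exact Ideal.Quotient.eq_zero_iff_mem.1 this.symm
  · refine Ideal.span_le.2 fun p hp => ?_
    obtain ⟨j, rfl⟩ := mem_listY.1 hp
    exact specY_castAdd j

lemma listRegularMod_listY : ListRegularMod ⊥ (listY k n) := by
  have := listRegularMod_X (k := k) (A := ∅) (l := (List.finRange 7).map (Fin.castAdd n))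
    (List.Nodup.map (Fin.castAdd_injective 7 n) (List.nodup_finRange 7)) (by simp)
  rwa [Set.image_empty, Ideal.span_empty] at this

lemma isHomogeneous_listY : ∀ l ∈ listY k n, l.IsHomogeneous 1 := by
  intro l hl
  obtain ⟨j, rfl⟩ := mem_listY.1 hl
  exact isHomogeneous_X k _

lemma isHomogeneous_inclX {p : MvPolynomial (Fin n) k} {d : ℕ} (hp : p.IsHomogeneous d) :
    (inclX p).IsHomogeneous d :=
  hp.rename_isHomogeneous

/-- The elements of degree one of which the generic quadrics are formed, shifted by `lam`. -/
lemma isHomogeneous_shiftY_X {lam : Fin 7 → MvPolynomial (Fin n) k}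
    (hlam : ∀ j, (lam j).IsHomogeneous 1) (i : Fin (7 + n)) :
    (shiftY lam (X i)).IsHomogeneous 1 := by
  refine Fin.addCases (fun j => ?_) (fun i => ?_) i
  · rw [shiftY_castAdd]
    exact (isHomogeneous_X k _).add (isHomogeneous_inclX (hlam j))
  · rw [shiftY_natAdd]
    exact isHomogeneous_X k _

lemma isHomogeneous_shiftY {lam : Fin 7 → MvPolynomial (Fin n) k}
    (hlam : ∀ j, (lam j).IsHomogeneous 1) {p : MvPolynomial (Fin (7 + n)) k} {d : ℕ}
    (hp : p.IsHomogeneous d) : (shiftY lam p).IsHomogeneous d := by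
  have h := hp.aeval (fun i => shiftY lam (X i)) (n := 1) (isHomogeneous_shiftY_X hlam)
  rw [one_mul] at h
  convert h using 1
  exact DFunLike.congr_fun (MvPolynomial.algHom_ext fun i => by simp :
    shiftY lam = aeval fun i => shiftY lam (X i)) p

variable {lam : Fin 7 → MvPolynomial (Fin n) k}

/-- The generic quadrics shifted by `lam`. -/
noncomputable def shiftedQuadrics (lam : Fin 7 → MvPolynomial (Fin n) k) (i : Fin 4) :
    MvPolynomial (Fin (7 + n)) k :=
  shiftY lam (genericQuadrics k (Fin.castAdd n) i)

lemma isHomogeneous_shiftedQuadrics (hlam : ∀ j, (lam j).IsHomogeneous 1) (i : Fin 4) :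
    (shiftedQuadrics lam i).IsHomogeneous 2 :=
  isHomogeneous_shiftY hlam (isHomogeneous_genericQuadrics _ i)

lemma isGQuadratic_shiftedQuadrics (hlam : ∀ j, (lam j).IsHomogeneous 1) {s : Finset (Fin 4)}
    (h0 : 0 ∈ s) (h1 : 1 ∈ s) (h2 : ∀ i ∈ s, 2 ≤ i → 2 ∈ s ∧ 3 ∈ s) :
    IsGQuadratic (Ideal.span (shiftedQuadrics lam '' s)) := by
  classical
  refine ⟨(shiftYEquiv lam).symm, fun i => ?_, MonomialOrder.lex,
    s.image (genericQuadrics k (Fin.castAdd n)), ?_, ?_⟩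
  · exact isHomogeneous_shiftY_X (lam := -lam) (fun j => (hlam j).neg) i
  · intro g hg
    obtain ⟨i, -, rfl⟩ := Finset.mem_image.1 hg
    exact isHomogeneous_genericQuadrics _ i
  · have : (Ideal.span (shiftedQuadrics lam '' s)).map (shiftYEquiv lam).symm =
        Ideal.span (genericQuadrics k (Fin.castAdd n) '' s) := by
      rw [Ideal.map_span, Set.image_image]
      congr 1
      refine Set.image_congr fun i _ => ?_
      exact (shiftYEquiv lam).symm_apply_apply _
    rw [this]
    convert isGroebnerBasis_genericQuadrics (Fin.strictMono_castAdd n) h0 h1 h2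

lemma constantCoeff_eq_zero_of_isHomogeneous {σ : Type*} {p : MvPolynomial σ k} {d : ℕ}
    (hp : p.IsHomogeneous d) (hd : d ≠ 0) : constantCoeff p = 0 := by
  rw [constantCoeff_eq]
  exact hp.coeff_eq_zero (by simpa using hd.symm)

/-- An ideal is LG-quadratic if it is the specialization `Y = 0` of the ideal of shifted quadrics
and the variables `Y` form a regular sequence modulo the latter. -/
theorem isLGQuadratic_of_listRegularMod (hlam : ∀ j, (lam j).IsHomogeneous 1) {s : Finset (Fin 4)}
    (h0 : 0 ∈ s) (h1 : 1 ∈ s) (h2 : ∀ i ∈ s, 2 ≤ i → 2 ∈ s ∧ 3 ∈ s)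
    {I : Ideal (MvPolynomial (Fin n) k)}
    (hI : I = (Ideal.span (shiftedQuadrics lam '' s)).map specY)
    (hreg : ListRegularMod (Ideal.span (shiftedQuadrics lam '' s)) (listY k n)) :
    IsLGQuadratic I := by
  set J := Ideal.span (shiftedQuadrics lam '' s) with hJ
  have hsurj : Function.Surjective (specY (k := k) (n := n)) := fun p => ⟨inclX p, specY_inclX p⟩
  have hcomap : I.comap specY = J ⊔ Ideal.ofList (listY k n) := by
    rw [hI, Ideal.comap_map_of_surjective' _ hsurj, ker_specY]
  -- All generators have positive degree; this gives the nonzero quotient that `IsRegular` demands.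
  have hle : J ⊔ Ideal.ofList (listY k n) ≤ RingHom.ker (constantCoeff (R := k)) := by
    refine sup_le (Ideal.span_le.2 ?_) (Ideal.span_le.2 ?_)
    · rintro _ ⟨i, -, rfl⟩
      exact constantCoeff_eq_zero_of_isHomogeneous (isHomogeneous_shiftedQuadrics hlam i) two_ne_zero
    · intro p hp
      exact constantCoeff_eq_zero_of_isHomogeneous (isHomogeneous_listY p hp) one_ne_zero
  refine ⟨7 + n, J, listY k n, isGQuadratic_shiftedQuadrics hlam h0 h1 h2, isHomogeneous_listY,
    ⟨hreg.isWeaklyRegular, ?_⟩, ?_⟩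
  · intro htop
    have hmap : (Ideal.ofList (listY k n) • ⊤ :
        Submodule (MvPolynomial (Fin (7 + n)) k) (MvPolynomial (Fin (7 + n)) k ⧸ J)) =
        Submodule.map J.mkQ (Ideal.ofList (listY k n)) := by
      rw [← Submodule.range_mkQ J, ← Submodule.map_top, ← Submodule.map_smul'']
      congr 1
      simp
    have h1 : Ideal.Quotient.mk J 1 ∈ (Ideal.ofList (listY k n) • ⊤ :
        Submodule (MvPolynomial (Fin (7 + n)) k) (MvPolynomial (Fin (7 + n)) k ⧸ J)) := by
      rw [← htop]; trivial
    rw [hmap] at h1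
    obtain ⟨t, ht, hts⟩ := h1
    have h2 := (Submodule.Quotient.eq J).1 hts
    have h3 := hle (Submodule.mem_sup_left h2)
    have h4 := hle (Submodule.mem_sup_right ht)
    rw [RingHom.mem_ker] at h3 h4
    rw [map_sub, h4, map_one] at h3
    simp at h3
  · let F : (MvPolynomial (Fin n) k ⧸ I) →ₐ[k]
        (MvPolynomial (Fin (7 + n)) k ⧸ (J ⊔ Ideal.ofList (listY k n))) :=
      Ideal.Quotient.liftₐ I ((Ideal.Quotient.mkₐ k _).comp inclX) (by
        intro a ha
        refine Ideal.Quotient.eq_zero_iff_mem.2 ?_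
        rw [← hcomap, Ideal.mem_comap]
        exact (specY_inclX a).symm ▸ ha)
    let G : (MvPolynomial (Fin (7 + n)) k ⧸ (J ⊔ Ideal.ofList (listY k n))) →ₐ[k]
        (MvPolynomial (Fin n) k ⧸ I) :=
      Ideal.Quotient.liftₐ _ ((Ideal.Quotient.mkₐ k I).comp specY) (by
        intro a ha
        refine Ideal.Quotient.eq_zero_iff_mem.2 ?_
        rwa [← hcomap, Ideal.mem_comap] at ha)
    have hF : ∀ p, F (Ideal.Quotient.mk I p) = Ideal.Quotient.mk _ (inclX p) := fun p => rfl
    have hG : ∀ p, G (Ideal.Quotient.mk _ p) = Ideal.Quotient.mk I (specY p) := fun p => rfl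
    have hFG : ∀ q, F (G q) = q := by
      intro q
      obtain ⟨p, rfl⟩ := Ideal.Quotient.mk_surjective q
      rw [hG, hF, Ideal.Quotient.eq, ← hcomap, Ideal.mem_comap]
      simp
    have hGF : ∀ q, G (F q) = q := by
      intro q
      obtain ⟨p, rfl⟩ := Ideal.Quotient.mk_surjective q
      rw [hF, hG, specY_inclX]
    refine ⟨AlgEquiv.ofAlgHom F G (AlgHom.ext hFG) (AlgHom.ext hGF), fun i =>
      ⟨inclX (X i), isHomogeneous_inclX (isHomogeneous_X k i), hF _⟩⟩

lemma isGraded_bot {σ : Type*} : IsGraded (⊥ : Ideal (MvPolynomial σ k)) :=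
  Ideal.IsHomogeneous.bot _

lemma mem_sup_listY {s : Set (MvPolynomial (Fin (7 + n)) k)} {p : MvPolynomial (Fin (7 + n)) k} :
    p ∈ (⊥ ⊔ Ideal.ofList (listY k n)) ⊔ Ideal.span s ↔ specY p ∈ Ideal.span (specY '' s) := by
  have hsurj : Function.Surjective (specY (k := k) (n := n)) := fun p => ⟨inclX p, specY_inclX p⟩
  rw [bot_sup_eq, sup_comm, ← ker_specY, ← Ideal.comap_map_of_surjective' _ hsurj, Ideal.mem_comap,
    Ideal.map_span]

lemma mem_bot_sup_listY {p : MvPolynomial (Fin (7 + n)) k} :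
    p ∈ (⊥ ⊔ Ideal.ofList (listY k n)) ↔ specY p = 0 := by
  rw [bot_sup_eq, ← ker_specY, RingHom.mem_ker]

lemma pairRegularMod_listY {f g : MvPolynomial (Fin (7 + n)) k}
    (h : PairRegularMod ⊥ (specY f) (specY g)) :
    PairRegularMod (⊥ ⊔ Ideal.ofList (listY k n)) f g := by
  refine ⟨fun s hs => ?_, fun s hs => ?_⟩
  · rw [mem_bot_sup_listY] at hs ⊢
    rw [map_mul] at hs
    exact h.1 _ hs
  · rw [mem_sup_listY] at hs ⊢
    rw [map_mul] at hs
    have := h.2 (specY s)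
    simp only [bot_sup_eq, Set.image_singleton] at this hs ⊢
    exact this hs

/-- Since `(Y)` is the kernel of `specY`, the conditions modulo `(Y)` are those on the
specializations in `S`: the starting point of the lifting. -/
lemma linkedMod_listY {x y z f g : MvPolynomial (Fin (7 + n)) k}
    (h : LinkedMod ⊥ (specY x) (specY y) (specY z) (specY f) (specY g)) :
    LinkedMod (⊥ ⊔ Ideal.ofList (listY k n)) x y z f g := by
  refine ⟨pairRegularMod_listY h.linear, pairRegularMod_listY h.quadrics, fun p hp hzp => ?_⟩
  rw [mem_sup_listY] at hp hzp ⊢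
  rw [map_mul] at hzp
  have := h.link (specY p)
  simp only [bot_sup_eq, Set.image_pair] at this hp hzp ⊢
  exact this hp hzp

section

variable {a b c d x y z : MvPolynomial (Fin n) k}

theorem isLGQuadratic_of_linkedMod (ha : a.IsHomogeneous 1) (hb : b.IsHomogeneous 1)
    (hc : c.IsHomogeneous 1) (hd : d.IsHomogeneous 1) (hx : x.IsHomogeneous 1)
    (hy : y.IsHomogeneous 1) (hz : z.IsHomogeneous 1)
    (h : LinkedMod ⊥ x y z (a * x + b * y) (c * x + d * y)) :
    IsLGQuadratic (Ideal.span {x * z, y * z, a * x + b * y, c * x + d * y}) := by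
  -- The signs turn the generic binomials `v₀v₂ - v₅v₃` and `v₁v₃ - v₆v₂` into `ax + by` and `dy +
  -- cx`.
  set lam : Fin 7 → MvPolynomial (Fin n) k := ![a, d, x, y, z, -b, -c] with hlamdef
  have hlam : ∀ j, (lam j).IsHomogeneous 1 := by
    intro j; fin_cases j; exacts [ha, hd, hx, hy, hz, hb.neg, hc.neg]
  have hq : ∀ j, ∃ p : MvPolynomial (Fin (7 + n)) k, p.IsHomogeneous 1 ∧ specY p = lam j ∧
      shiftY lam (X (Fin.castAdd n j)) = p := fun j =>
    ⟨_, isHomogeneous_shiftY_X hlam _, by simp, rfl⟩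
  choose Y hY hYs hYlam using hq
  have e : shiftedQuadrics lam '' (Finset.univ : Finset (Fin 4)) =
      {Y 2 * Y 4, Y 3 * Y 4, Y 0 * Y 2 - Y 5 * Y 3, Y 1 * Y 3 - Y 6 * Y 2} := by
    ext p
    simp [shiftedQuadrics, genericQuadrics, Fin.exists_fin_succ, hYlam]
    tauto
  refine isLGQuadratic_of_listRegularMod hlam (s := Finset.univ) (by simp) (by simp) (by simp) ?_ ?_
  · rw [e, Ideal.map_span]
    simp only [Set.image_insert_eq, Set.image_singleton, map_sub, map_mul, hYs]
    congr 1
    simp [hlamdef, add_comm]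
  · rw [e]
    have hPx : Y 2 ∈ Ideal.span {Y 2, Y 3} := Ideal.subset_span (by simp)
    have hPy : Y 3 ∈ Ideal.span {Y 2, Y 3} := Ideal.subset_span (by simp)
    have := (LinkedMod.lift_list (K := ⊥) (x := Y 2) (y := Y 3) (z := Y 4)
      (f := Y 0 * Y 2 - Y 5 * Y 3) (g := Y 1 * Y 3 - Y 6 * Y 2) (hY 2)
      (((hY 0).mul (hY 2)).sub ((hY 5).mul (hY 3))) (((hY 1).mul (hY 3)).sub ((hY 6).mul (hY 2)))
      (sub_mem (Ideal.mul_mem_left _ _ hPx) (Ideal.mul_mem_left _ _ hPy))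
      (sub_mem (Ideal.mul_mem_left _ _ hPy) (Ideal.mul_mem_left _ _ hPx))
      isHomogeneous_listY isGraded_bot listRegularMod_listY (linkedMod_listY ?_)).2
    · rwa [bot_sup_eq] at this
    · simp only [map_sub, map_mul, hYs]
      convert h using 1 <;> simp [hlamdef]; ring

theorem isLGQuadratic_of_pairRegularMod (ha : a.IsHomogeneous 1) (hb : b.IsHomogeneous 1)
    (hc : c.IsHomogeneous 1) (hd : d.IsHomogeneous 1) (hx : x.IsHomogeneous 1)
    (hy : y.IsHomogeneous 1)
    (h : PairRegularMod ⊥ (a * x + b * y) (c * x + d * y)) :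
    IsLGQuadratic (Ideal.span {a * x + b * y, c * x + d * y}) := by
  set lam : Fin 7 → MvPolynomial (Fin n) k := ![a, d, x, y, 0, -b, -c] with hlamdef
  have hlam : ∀ j, (lam j).IsHomogeneous 1 := by
    intro j; fin_cases j; exacts [ha, hd, hx, hy, isHomogeneous_zero _ _ _, hb.neg, hc.neg]
  have hq : ∀ j, ∃ p : MvPolynomial (Fin (7 + n)) k, p.IsHomogeneous 1 ∧ specY p = lam j ∧
      shiftY lam (X (Fin.castAdd n j)) = p := fun j =>
    ⟨_, isHomogeneous_shiftY_X hlam _, by simp, rfl⟩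
  choose Y hY hYs hYlam using hq
  have e : shiftedQuadrics lam '' (({0, 1} : Finset (Fin 4)) : Set (Fin 4)) =
      {Y 0 * Y 2 - Y 5 * Y 3, Y 1 * Y 3 - Y 6 * Y 2} := by
    simp [Set.image_insert_eq, shiftedQuadrics, genericQuadrics, hYlam]
  refine isLGQuadratic_of_listRegularMod hlam (s := {0, 1}) (by simp) (by simp) (by decide) ?_ ?_
  · rw [e, Ideal.map_span]
    simp only [Set.image_insert_eq, Set.image_singleton, map_sub, map_mul, hYs]
    congr 1
    simp [hlamdef, add_comm]
  · rw [e]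
    have := (PairRegularMod.lift_list (K := ⊥) (f := Y 0 * Y 2 - Y 5 * Y 3)
      (g := Y 1 * Y 3 - Y 6 * Y 2) (((hY 0).mul (hY 2)).sub ((hY 5).mul (hY 3)))
      isHomogeneous_listY isGraded_bot listRegularMod_listY (pairRegularMod_listY ?_)).2
    · rwa [bot_sup_eq] at this
    · simp only [map_sub, map_mul, hYs]
      convert h using 1 <;> simp [hlamdef]; ring

end

end Assembly

/-! ### Linear forms and retractions modulo a linear form -/

section LinearForms

variable {k : Type*} [Field k] {n : ℕ}

lemma eq_sum_of_isHomogeneous_one {z : MvPolynomial (Fin n) k} (hz : z.IsHomogeneous 1) :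
    ∃ c : Fin n → k, z = ∑ j, C (c j) * X j := by
  have : z ∈ Submodule.span k (Set.range (X : Fin n → MvPolynomial (Fin n) k)) := by
    rw [← homogeneousSubmodule_one_eq_span_X]; exact hz
  obtain ⟨c, hc⟩ := (Submodule.mem_span_range_iff_exists_fun k).1 this
  exact ⟨c, by simp [← hc, smul_eq_C_mul]⟩

/-- For a linear form `z` there is a graded retraction of the polynomial ring with kernel `(z)`. -/
lemma exists_retraction {z : MvPolynomial (Fin n) k} (hz : z.IsHomogeneous 1) :
    ∃ ψ : MvPolynomial (Fin n) k →ₐ[k] MvPolynomial (Fin n) k,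
      (∀ p d, p.IsHomogeneous d → (ψ p).IsHomogeneous d) ∧ (∀ p, ψ p = 0 ↔ z ∣ p) ∧
        ∀ p, ψ (ψ p) = ψ p := by
  obtain ⟨c, hc⟩ := eq_sum_of_isHomogeneous_one hz
  by_cases h : ∃ i, c i ≠ 0
  swap
  · push Not at h
    have hz0 : z = 0 := by rw [hc]; simp [h]
    exact ⟨AlgHom.id k _, fun p d h => h, fun p => by simp [hz0], fun p => rfl⟩
  obtain ⟨i, hi⟩ := h
  -- Only the variable `X i`, which occurs in `z` with coefficient `c i ≠ 0`, is moved: it is solved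
  -- for from `z = 0`.
  let ψ : MvPolynomial (Fin n) k →ₐ[k] MvPolynomial (Fin n) k :=
    aeval fun j => X j - C (if j = i then (c i)⁻¹ else 0) * z
  have hψz : ψ z = 0 := by
    have : ψ z = ∑ j, C (c j) * (X j - C (if j = i then (c i)⁻¹ else 0) * z) := by
      conv_lhs => rw [hc]
      simp [ψ, algHom_C, algebraMap_eq]
    rw [this]
    simp only [mul_sub, Finset.sum_sub_distrib, ← hc, ← mul_assoc, ← C_mul, ← Finset.sum_mul]
    rw [Finset.sum_eq_single i (by intro j _ hj; simp [hj]) (by simp)]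
    simp [hi]
  have hdvd : ∀ p, z ∣ p - ψ p := by
    intro p
    have : (Ideal.Quotient.mkₐ k (Ideal.span {z})).comp ψ =
        Ideal.Quotient.mkₐ k (Ideal.span {z}) := by
      refine MvPolynomial.algHom_ext fun j => ?_
      have hz' : Ideal.Quotient.mk (Ideal.span {z}) z = 0 :=
        Ideal.Quotient.eq_zero_iff_mem.2 (Ideal.mem_span_singleton_self z)
      simp [ψ, hz']
    have := DFunLike.congr_fun this p
    exact Ideal.mem_span_singleton.1 (Ideal.Quotient.eq.1 this.symm)
  refine ⟨ψ, fun p d hp => ?_, fun p => ⟨fun h => ?_, ?_⟩, fun p => ?_⟩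
  · have := hp.aeval (fun j => X j - C (if j = i then (c i)⁻¹ else 0) * z) (n := 1) fun j =>
      (isHomogeneous_X k j).sub (hz.C_mul _)
    rwa [one_mul] at this
  · simpa [h] using hdvd p
  · rintro ⟨r, rfl⟩
    simp [hψz]
  · obtain ⟨r, hr⟩ := hdvd p
    have := congrArg ψ hr
    rw [map_sub, map_mul, hψz, zero_mul, sub_eq_zero] at this
    exact this.symm

lemma not_isUnit_of_isHomogeneous_one {z : MvPolynomial (Fin n) k} (hz : z.IsHomogeneous 1) :
    ¬ IsUnit z := by
  intro h
  have := h.map (constantCoeff (R := k) (σ := Fin n))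
  rw [constantCoeff_eq_zero_of_isHomogeneous hz one_ne_zero] at this
  simp at this

end LinearForms

/-! ### Height bounds from Krull's theorem -/

section Heights

variable {R : Type*} [CommRing R] [IsNoetherianRing R]

lemma height_span_singleton_le {p : R} (h : Ideal.span {p} ≠ ⊤) :
    (Ideal.span {p}).height ≤ 1 :=
  Ideal.height_span_singleton_le_one fun hp => h (Ideal.span_singleton_eq_top.2 hp)

lemma height_span_pair_le {p q : R} (h : Ideal.span {p, q} ≠ ⊤) :
    (Ideal.span {p, q}).height ≤ 2 := by
  refine (Ideal.height_le_spanFinrank _ h).trans ?_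
  have h1 := Submodule.spanFinrank_span_le_ncard_of_finite (R := R) (s := {p, q}) (Set.toFinite _)
  have h2 : ({p, q} : Set R).ncard ≤ 2 := 
    (Set.ncard_insert_le p {q}).trans (by rw [Set.ncard_singleton])
  exact_mod_cast h1.trans h2

/-- A nonunit common divisor `p` would enclose the ideal in `(p)`, of height at most one. -/
lemma isRelPrime_of_height_eq_two {f g : R} (h : (Ideal.span {f, g}).height = 2) :
    IsRelPrime f g := by
  intro p hf hg
  by_contra hp
  have h1 : Ideal.span {f, g} ≤ Ideal.span {p} := Ideal.span_le.2 (by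
    rintro _ (rfl | rfl)
    exacts [Ideal.mem_span_singleton.2 hf, Ideal.mem_span_singleton.2 hg])
  have h2 := (Ideal.height_mono h1).trans
    (height_span_singleton_le fun h => hp (Ideal.span_singleton_eq_top.1 h))
  rw [h] at h2
  exact absurd h2 (by norm_num)

lemma ne_zero_of_height_eq_two {f g : R} (h : (Ideal.span {f, g}).height = 2) : f ≠ 0 := by
  rintro rfl
  have hg : IsUnit g := isRelPrime_of_height_eq_two h (dvd_zero g) dvd_rfl
  rw [Ideal.eq_top_of_isUnit_mem _ (Ideal.subset_span (by simp)) hg, Ideal.height_top] at h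
  exact absurd h (by decide)

end Heights

/-! ### Coprimality and reduced fractions in a factorial domain -/

section UFD

variable {R : Type*} [CommRing R] [IsDomain R] [UniqueFactorizationMonoid R]

lemma IsRelPrime.pairRegularMod {f g : R} (hf : f ≠ 0) (h : IsRelPrime f g) :
    PairRegularMod ⊥ f g := by
  refine ⟨fun s hs => ?_, fun s hs => ?_⟩
  · rw [Ideal.mem_bot] at hs ⊢
    exact (mul_eq_zero.1 hs).resolve_left hf
  · rw [bot_sup_eq, Ideal.mem_span_singleton] at hs ⊢
    exact h.dvd_of_dvd_mul_left hs

/-- Write `A/g = num/den` in lowest terms; then `(A, B) = (num/den)(g, -f)`. The denominator divides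
`f` because `B` is integral, and `D` because `D * num = M * den`. -/
lemma exists_common_denominator_of_ne_zero {f g D A B M : R} (hg : g ≠ 0) (h1 : D * A = M * g)
    (h3 : A * f + B * g = 0) :
    ∃ den num, den ∣ f ∧ den ∣ g ∧ den ∣ D ∧ A * den = num * g ∧ B * den = -(num * f) := by
  obtain ⟨den, num, e, hrel, rfl, rfl⟩ := UniqueFactorizationMonoid.exists_reduced_factors g hg A
  have he : e ≠ 0 := left_ne_zero_of_mul hg
  have h4 : num * f = -(B * den) := mul_left_cancel₀ he (by linear_combination h3)
  have h5 : D * num = M * den := mul_left_cancel₀ he (by linear_combination h1)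
  refine ⟨den, num, hrel.dvd_of_dvd_mul_left ?_, dvd_mul_left _ _, hrel.dvd_of_dvd_mul_right ?_,
    by ring, ?_⟩
  · rw [h4]; exact (dvd_mul_left _ _).neg_right
  · rw [h5]; exact dvd_mul_left _ _
  · rw [h4, neg_neg]

lemma exists_common_denominator {f g D A B M : R} (hfg : f ≠ 0 ∨ g ≠ 0) (h1 : D * A = M * g)
    (h2 : D * B = -(M * f)) (h3 : A * f + B * g = 0) :
    ∃ den num, den ∣ f ∧ den ∣ g ∧ den ∣ D ∧ A * den = num * g ∧ B * den = -(num * f) := by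
  rcases hfg with hf | hg
  · obtain ⟨den, num, h4, h5, h6, h7, h8⟩ := exists_common_denominator_of_ne_zero (f := g) (g := f)
      (D := D) (A := B) (B := A) (M := -M) hf (by linear_combination h2) (by linear_combination h3)
    exact ⟨den, -num, h5, h4, h6, by linear_combination h8, by linear_combination h7⟩
  · exact exists_common_denominator_of_ne_zero hg h1 h3

end UFD

/-! ### The explicit form (b) -/

section FormIII

variable {k : Type*} [Field k] {n : ℕ}

/-- If `(f, g)` has no common factor and `(z, f, g, D)` has height three, then an element of
`(f, g) : (z, D)` lies in `(f, g)`. -/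
lemma mem_span_pair_of_height_eq_three {z f g D p : MvPolynomial (Fin n) k}
    (hz : z.IsHomogeneous 1) (hz0 : z ≠ 0) (hf : f ≠ 0) (hfg : IsRelPrime f g)
    (hht : (Ideal.span {z, f, g, D}).height = 3)
    (hzp : z * p ∈ Ideal.span {f, g}) (hDp : D * p ∈ Ideal.span {f, g}) :
    p ∈ Ideal.span {f, g} := by
  obtain ⟨A, B, hAB⟩ := Ideal.mem_span_pair.1 hzp
  obtain ⟨A', B', hAB'⟩ := Ideal.mem_span_pair.1 hDp
  obtain ⟨ψ, -, hker, hidem⟩ := exists_retraction hz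
  have hψz : ψ z = 0 := (hker z).2 dvd_rfl
  have e1 : (D * A - z * A') * f = (z * B' - D * B) * g := by
    linear_combination D * hAB - z * hAB'
  -- Eliminating `p` from the two memberships gives a relation between `f` and `g`; by coprimality
  -- it is a multiple `M` of the Koszul relation.
  obtain ⟨M, hM⟩ := hfg.dvd_of_dvd_mul_right (Dvd.intro_left _ e1)
  have hM' : D * A - z * A' = M * g := mul_right_cancel₀ hf (by rw [e1, hM]; ring)
  have h1 : ψ D * ψ A = ψ M * ψ g := by
    have := congrArg ψ hM'
    simpa [hψz] using this
  have h2 : ψ D * ψ B = -(ψ M * ψ f) := by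
    have := congrArg ψ hM
    simp only [map_sub, map_mul, hψz] at this
    linear_combination -this
  have h3 : ψ A * ψ f + ψ B * ψ g = 0 := by
    have := congrArg ψ hAB
    simpa [hψz] using this
  have hne : ψ f ≠ 0 ∨ ψ g ≠ 0 := by
    by_contra! h
    exact not_isUnit_of_isHomogeneous_one hz (hfg ((hker f).1 h.1) ((hker g).1 h.2))
  obtain ⟨den, num, hdf, hdg, hdD, hA, hB⟩ := exists_common_denominator hne h1 h2 h3
  have hmem : ∀ q, den ∣ ψ q → q ∈ Ideal.span {z, den} := by
    intro q hq
    obtain ⟨r, hr⟩ := (hker (q - ψ q)).1 (by rw [map_sub, hidem, sub_self])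
    have : q = z * r + ψ q := by rw [← hr]; ring
    rw [this]
    exact add_mem (Ideal.mul_mem_right _ _ (Ideal.subset_span (by simp)))
      (Ideal.mem_of_dvd _ hq (Ideal.subset_span (by simp)))
  -- All of `z, f, g, D` lie in `(z, den)`, which would have height at most two if proper. So `den`
  -- is a unit modulo `z` and `(A, B)` is there a multiple of `(g, -f)`; subtracting that multiple
  -- makes `z` cancellable.
  have htop : Ideal.span {z, den} = ⊤ := by
    by_contra h
    have hle : Ideal.span {z, f, g, D} ≤ Ideal.span {z, den} := Ideal.span_le.2 (by
      rintro _ (rfl | rfl | rfl | rfl)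
      exacts [Ideal.subset_span (by simp), hmem _ hdf, hmem _ hdg, hmem _ hdD])
    have := (Ideal.height_mono hle).trans (height_span_pair_le h)
    rw [hht] at this
    exact absurd this (by norm_num)
  obtain ⟨r, b, hrb⟩ := Ideal.mem_span_pair.1 ((Ideal.eq_top_iff_one _).1 htop)
  have hb : ψ b * ψ den = 1 := by
    have := congrArg ψ hrb
    simpa [hψz] using this
  have hA' : ψ (A - ψ num * ψ b * g) = 0 := by
    have := congrArg ψ hA
    simp only [map_mul, map_sub, hidem] at this ⊢
    linear_combination ψ b * this - ψ A * hb
  have hB' : ψ (B + ψ num * ψ b * f) = 0 := by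
    have := congrArg ψ hB
    simp only [map_mul, map_add, map_neg, hidem] at this ⊢
    linear_combination ψ b * this - ψ B * hb
  obtain ⟨A2, hA2⟩ := (hker _).1 hA'
  obtain ⟨B2, hB2⟩ := (hker _).1 hB'
  refine Ideal.mem_span_pair.2 ⟨A2, B2, mul_left_cancel₀ hz0 ?_⟩
  linear_combination hAB - f * hA2 - g * hB2

theorem isLGQuadratic_of_hasFormIII {I : Ideal (MvPolynomial (Fin n) k)} (hI : HasFormIII I) :
    IsLGQuadratic I := by
  obtain ⟨x, y, z, a, c, b, d, hx, hy, hz, ha, hc, hb, hd, rfl, hxy, hfg, hht⟩ := hI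
  have hrel := isRelPrime_of_height_eq_two hfg
  have hf0 := ne_zero_of_height_eq_two hfg
  have hquad := hrel.pairRegularMod hf0
  by_cases hz0 : z = 0
  · subst hz0
    have : Ideal.span {x * 0, y * 0, a * x + b * y, c * x + d * y} =
        Ideal.span {a * x + b * y, c * x + d * y} := by
      simp
    rw [this]
    exact isLGQuadratic_of_pairRegularMod ha hb hc hd hx hy hquad
  refine isLGQuadratic_of_linkedMod ha hb hc hd hx hy hz
    ⟨(isRelPrime_of_height_eq_two hxy).pairRegularMod (ne_zero_of_height_eq_two hxy), hquad, ?_⟩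
  simp only [bot_sup_eq]
  intro p hp hzp
  refine mem_span_pair_of_height_eq_three hz hz0 hf0 hrel hht hzp ?_
  obtain ⟨u, v, rfl⟩ := Ideal.mem_span_pair.1 hp
  -- Cramer's rule for `f = ax + by`, `g = cx + dy`.
  exact Ideal.mem_span_pair.2 ⟨u * d - v * c, v * a - u * b, by ring⟩

end FormIII

/-! ### Divisibility between forms -/

section Degree

variable {k : Type*} [Field k] {n : ℕ}

lemma exists_eq_mul_of_dvd {σ : Type*} {p g : MvPolynomial σ k} {d e : ℕ}
    (hp : p.IsHomogeneous (d + e)) (hg : g.IsHomogeneous d) (h : g ∣ p) :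
    ∃ r : MvPolynomial σ k, r.IsHomogeneous e ∧ p = g * r := by
  obtain ⟨r, rfl⟩ := h
  exact ⟨homogeneousComponent e r, homogeneousComponent_isHomogeneous e r, by
    rw [← homogeneousComponent_mul_add hg, homogeneousComponent_eq_self hp]⟩

lemma exists_eq_C_mul_of_dvd {σ : Type*} {p g : MvPolynomial σ k} {d : ℕ}
    (hp : p.IsHomogeneous d) (hg : g.IsHomogeneous d) (h : g ∣ p) : ∃ c : k, p = C c * g := by
  obtain ⟨r, hr, rfl⟩ := exists_eq_mul_of_dvd (e := 0) hp hg h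
  rw [← totalDegree_zero_iff_isHomogeneous, totalDegree_eq_zero_iff_eq_C] at hr
  exact ⟨_, by rw [mul_comm, ← hr]⟩

lemma eq_zero_of_dvd {σ : Type*} {p g : MvPolynomial σ k} {d e : ℕ}
    (hp : p.IsHomogeneous e) (hg : g.IsHomogeneous d) (hed : e < d) (h : g ∣ p) : p = 0 := by
  obtain ⟨r, rfl⟩ := h
  rw [← homogeneousComponent_eq_self hp, homogeneousComponent_mul_of_lt hg hed]

lemma prime_of_isHomogeneous_one {l : MvPolynomial (Fin n) k} (hl : l.IsHomogeneous 1)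
    (h0 : l ≠ 0) : Prime l := by
  obtain ⟨ψ, -, hker, -⟩ := exists_retraction hl
  refine ⟨h0, not_isUnit_of_isHomogeneous_one hl, fun a b hab => ?_⟩
  rw [← hker, ← hker, ← mul_eq_zero, ← map_mul, hker]
  exact hab

end Degree

/-! ### Syzygies of four quadrics, base changes, and the grade of the last map -/

section Syzygies

open Matrix

variable {k : Type*} [Field k] {n : ℕ}

/-- Four quadrics `q` whose module of syzygies is generated by the three columns of a matrix `D` of
linear forms, linearly independent over `k`, and a further column `κ` of quadrics. -/
structure QuadricSyzygies (q : Fin 4 → MvPolynomial (Fin n) k)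
    (D : Matrix (Fin 4) (Fin 3) (MvPolynomial (Fin n) k)) (κ : Fin 4 → MvPolynomial (Fin n) k) :
    Prop where
  q_hom : ∀ i, (q i).IsHomogeneous 2
  D_hom : ∀ i j, (D i j).IsHomogeneous 1
  κ_hom : ∀ i, (κ i).IsHomogeneous 2
  exact : ∀ v : Fin 4 → MvPolynomial (Fin n) k, v ⬝ᵥ q = 0 ↔
    ∃ (e : Fin 3 → MvPolynomial (Fin n) k) (t : MvPolynomial (Fin n) k), v = D *ᵥ e + t • κ
  indep : ∀ c : Fin 3 → k, D *ᵥ (fun j => C (c j)) = 0 → c = 0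

/-- `(u, z)` generates the relations between the columns of `D` and `κ`. -/
structure SecondSyzygy (D : Matrix (Fin 4) (Fin 3) (MvPolynomial (Fin n) k))
    (κ : Fin 4 → MvPolynomial (Fin n) k) (u : Fin 3 → MvPolynomial (Fin n) k)
    (z : MvPolynomial (Fin n) k) : Prop where
  u_hom : ∀ j, (u j).IsHomogeneous 2
  z_hom : z.IsHomogeneous 1
  rel : D *ᵥ u + z • κ = 0
  exact : ∀ (e : Fin 3 → MvPolynomial (Fin n) k) (t : MvPolynomial (Fin n) k),
    D *ᵥ e + t • κ = 0 → ∃ s, e = s • u ∧ t = s * z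
  ne_zero : u ≠ 0 ∨ z ≠ 0

variable {q : Fin 4 → MvPolynomial (Fin n) k}
  {D : Matrix (Fin 4) (Fin 3) (MvPolynomial (Fin n) k)} {κ : Fin 4 → MvPolynomial (Fin n) k}

/-- A matrix of constants as a matrix of polynomials. -/
noncomputable def constMatrix {m₁ m₂ : Type*} (n : ℕ) (P : Matrix m₁ m₂ k) :
    Matrix m₁ m₂ (MvPolynomial (Fin n) k) :=
  P.map C

lemma constMatrix_mul {m₁ m₂ m₃ : Type*} [Fintype m₂] (P : Matrix m₁ m₂ k) (Q : Matrix m₂ m₃ k) :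
    constMatrix n P * constMatrix n Q = constMatrix n (P * Q) :=
  (Matrix.map_mul (f := (C : k →+* MvPolynomial (Fin n) k))).symm

lemma constMatrix_one {m₁ : Type*} [DecidableEq m₁] :
    constMatrix n (1 : Matrix m₁ m₁ k) = 1 := by
  exact Matrix.map_one _ (map_zero C) (map_one C)

lemma constMatrix_mulVec {m₁ m₂ : Type*} [Fintype m₂] (P : Matrix m₁ m₂ k) (c : m₂ → k) :
    (constMatrix n P *ᵥ fun j => C (c j)) = fun j => C ((P *ᵥ c) j) := by
  funext j
  simp [mulVec, dotProduct, constMatrix]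

namespace QuadricSyzygies

lemma col_dotProduct (h : QuadricSyzygies q D κ) (e : Fin 3 → MvPolynomial (Fin n) k)
    (t : MvPolynomial (Fin n) k) : (D *ᵥ e + t • κ) ⬝ᵥ q = 0 :=
  (h.exact _).2 ⟨e, t, rfl⟩

lemma mulVec_dotProduct (h : QuadricSyzygies q D κ) (e : Fin 3 → MvPolynomial (Fin n) k) :
    (D *ᵥ e) ⬝ᵥ q = 0 := by
  simpa using h.col_dotProduct e 0

/-- Minimality: all syzygies have entries without constant term. -/
lemma q_indep (h : QuadricSyzygies q D κ) (c : Fin 4 → k)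
    (hc : (fun i => C (c i)) ⬝ᵥ q = 0) : c = 0 := by
  obtain ⟨e, t, het⟩ := (h.exact _).1 hc
  funext i
  have := congrArg constantCoeff (congrFun het i)
  simpa [mulVec, dotProduct, constantCoeff_eq_zero_of_isHomogeneous (h.D_hom i _) one_ne_zero,
    constantCoeff_eq_zero_of_isHomogeneous (h.κ_hom i) two_ne_zero] using this

lemma exists_of_isHomogeneous_one (h : QuadricSyzygies q D κ)
    {v : Fin 4 → MvPolynomial (Fin n) k} (hv : ∀ i, (v i).IsHomogeneous 1) (hvq : v ⬝ᵥ q = 0) :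
    ∃ c : Fin 3 → k, v = D *ᵥ fun j => C (c j) := by
  obtain ⟨e, t, het⟩ := (h.exact _).1 hvq
  refine ⟨fun j => coeff 0 (e j), funext fun i => ?_⟩
  have := congrArg (homogeneousComponent 1) (congrFun het i)
  rw [homogeneousComponent_eq_self (hv i)] at this
  rw [this]
  have hD : ∀ j, homogeneousComponent 1 (D i j * e j) = D i j * C (coeff 0 (e j)) := fun j => by
    rw [← homogeneousComponent_zero]
    exact homogeneousComponent_mul_add (h.D_hom i j) 0
  have hκ : homogeneousComponent 1 (t * κ i) = 0 := by
    rw [mul_comm]; exact homogeneousComponent_mul_of_lt (h.κ_hom i) one_lt_two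
  simp [mulVec, dotProduct, hD, hκ]

lemma exists_of_isHomogeneous_two (h : QuadricSyzygies q D κ)
    {v : Fin 4 → MvPolynomial (Fin n) k} (hv : ∀ i, (v i).IsHomogeneous 2) (hvq : v ⬝ᵥ q = 0) :
    ∃ (e : Fin 3 → MvPolynomial (Fin n) k) (c : k), (∀ j, (e j).IsHomogeneous 1) ∧
      v = D *ᵥ e + (C c : MvPolynomial (Fin n) k) • κ := by
  obtain ⟨e, t, het⟩ := (h.exact _).1 hvq
  refine ⟨fun j => homogeneousComponent 1 (e j), coeff 0 t,
    fun j => homogeneousComponent_isHomogeneous 1 _, funext fun i => ?_⟩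
  have := congrArg (homogeneousComponent 2) (congrFun het i)
  rw [homogeneousComponent_eq_self (hv i)] at this
  rw [this]
  have hD : ∀ j, homogeneousComponent 2 (D i j * e j) = D i j * homogeneousComponent 1 (e j) :=
    fun j => homogeneousComponent_mul_add (h.D_hom i j) 1
  have hκ : homogeneousComponent 2 (t * κ i) = C (coeff 0 t) * κ i := by
    rw [mul_comm, mul_comm (C _), ← homogeneousComponent_zero]
    exact homogeneousComponent_mul_add (h.κ_hom i) 0
  simp [mulVec, dotProduct, hD, hκ]

lemma isHomogeneous_map_C_mulVec {m₁ m₂ : Type*} [Fintype m₂] (P : Matrix m₁ m₂ k)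
    {v : m₂ → MvPolynomial (Fin n) k} {d : ℕ} (hv : ∀ i, (v i).IsHomogeneous d) (i : m₁) :
    ((constMatrix n P *ᵥ v) i).IsHomogeneous d :=
  IsHomogeneous.sum _ _ _ fun j _ => (hv j).C_mul _

/-- Change of basis of the quadrics. -/
lemma row_change (h : QuadricSyzygies q D κ) {P P' : Matrix (Fin 4) (Fin 4) k} (hP : P * P' = 1)
    (hP' : P' * P = 1) :
    QuadricSyzygies (q ᵥ* (constMatrix n P')) (constMatrix n P * D) (constMatrix n P *ᵥ κ) := by
  have h1 : (constMatrix n P * constMatrix n P' : Matrix (Fin 4) (Fin 4) (MvPolynomial (Fin n) k)) = 1 := by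
    rw [constMatrix_mul, hP, constMatrix_one]
  have h2 : (constMatrix n P' * constMatrix n P : Matrix (Fin 4) (Fin 4) (MvPolynomial (Fin n) k)) = 1 := by
    rw [constMatrix_mul, hP', constMatrix_one]
  refine ⟨fun i => ?_, fun i j => ?_, isHomogeneous_map_C_mulVec P h.κ_hom, fun v => ?_,
    fun c hc => h.indep c ?_⟩
  · exact IsHomogeneous.sum _ _ _ fun j _ => by
      rw [mul_comm]; exact (h.q_hom j).C_mul _
  · exact isHomogeneous_map_C_mulVec P (fun i => h.D_hom i j) i
  · have e1 : v ⬝ᵥ (q ᵥ* (constMatrix n P')) = (constMatrix n P' *ᵥ v) ⬝ᵥ q := by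
      rw [dotProduct_comm, ← dotProduct_mulVec, dotProduct_comm]
    rw [e1, h.exact]
    constructor
    · rintro ⟨e, t, het⟩
      refine ⟨e, t, ?_⟩
      have := congrArg (constMatrix n P *ᵥ ·) het
      simpa only [mulVec_mulVec, h1, one_mulVec, mulVec_add, mulVec_smul] using this
    · rintro ⟨e, t, rfl⟩
      refine ⟨e, t, ?_⟩
      rw [mulVec_add, mulVec_smul, mulVec_mulVec, mulVec_mulVec, ← Matrix.mul_assoc, h2,
        Matrix.one_mul, one_mulVec]
  · have := congrArg (constMatrix n P' *ᵥ ·) hc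
    simpa only [mulVec_mulVec, ← Matrix.mul_assoc, h2, Matrix.one_mul, mulVec_zero] using this

lemma span_row_change {P P' : Matrix (Fin 4) (Fin 4) k} (hP' : P' * P = 1) :
    Ideal.span (Set.range (q ᵥ* (constMatrix n P'))) = Ideal.span (Set.range q) := by
  have key : ∀ (M : Matrix (Fin 4) (Fin 4) k) (q : Fin 4 → MvPolynomial (Fin n) k),
      Ideal.span (Set.range (q ᵥ* (constMatrix n M))) ≤ Ideal.span (Set.range q) := by
    intro M q
    refine Ideal.span_le.2 ?_
    rintro _ ⟨i, rfl⟩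
    have hq : ∀ j, q j ∈ Ideal.span (Set.range q) := fun j =>
      Ideal.subset_span (Set.mem_range_self j)
    simp only [vecMul, dotProduct, SetLike.mem_coe]
    exact Ideal.sum_mem _ fun j _ => Ideal.mul_mem_right _ _ (hq j)
  refine le_antisymm (key _ _) ?_
  conv_lhs => rw [show q = (q ᵥ* (constMatrix n P')) ᵥ* (constMatrix n P) by
    rw [vecMul_vecMul, constMatrix_mul, hP', constMatrix_one, vecMul_one]]
  exact key _ _

/-- Change of basis of the linear syzygies. -/
lemma col_change (h : QuadricSyzygies q D κ) {Q Q' : Matrix (Fin 3) (Fin 3) k} (hQ : Q * Q' = 1)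
    (hQ' : Q' * Q = 1) : QuadricSyzygies q (D * constMatrix n Q) κ := by
  have h1 : (constMatrix n Q * constMatrix n Q' : Matrix (Fin 3) (Fin 3) (MvPolynomial (Fin n) k)) = 1 := by
    rw [constMatrix_mul, hQ, constMatrix_one]
  refine ⟨h.q_hom, fun i j => ?_, h.κ_hom, fun v => ?_, fun c hc => ?_⟩
  · exact IsHomogeneous.sum _ _ _ fun l _ => by
      rw [mul_comm]; exact (h.D_hom i l).C_mul _
  · rw [h.exact]
    constructor
    · rintro ⟨e, t, rfl⟩
      refine ⟨constMatrix n Q' *ᵥ e, t, ?_⟩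
      rw [mulVec_mulVec, Matrix.mul_assoc, h1, Matrix.mul_one]
    · rintro ⟨e, t, rfl⟩
      exact ⟨constMatrix n Q *ᵥ e, t, by rw [mulVec_mulVec]⟩
  · rw [← mulVec_mulVec, constMatrix_mulVec] at hc
    have := congrArg (Q' *ᵥ ·) (h.indep _ hc)
    simpa [mulVec_mulVec, hQ'] using this

variable {u : Fin 3 → MvPolynomial (Fin n) k} {z : MvPolynomial (Fin n) k}

/-- The entries of the second syzygy generate an ideal of grade at least three. -/
lemma mem_of_forall_mul_mem (h : QuadricSyzygies q D κ) (hs : SecondSyzygy D κ u z)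
    {s g : MvPolynomial (Fin n) k} (hg : ¬ z ∣ g) (hsu : ∀ j, s * u j ∈ Ideal.span {z, g}) :
    s ∈ Ideal.span {z, g} := by
  choose α β hαβ using fun j => Ideal.mem_span_pair.1 (hsu j)
  have hsu' : s • u = z • α + g • β := funext fun j => by
    simp only [Pi.smul_apply, Pi.add_apply, smul_eq_mul, ← hαβ]; ring
  -- This is `s (D u + z κ) = 0` with `s u = z α + g β` inserted. For `z ≠ 0` it makes `D β`
  -- divisible by `z`; the quotient `γ` is again a syzygy, and expressing it by `D` and `κ` gives a
  -- second syzygy whose last entry is `s` modulo `g`.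
  have hD : z • (D *ᵥ α + s • κ) + g • (D *ᵥ β) = 0 := by
    have h0 : s • (D *ᵥ u + z • κ) = 0 := by rw [hs.rel, smul_zero]
    rw [smul_add, ← mulVec_smul, hsu', mulVec_add, mulVec_smul, mulVec_smul] at h0
    rw [← h0, smul_add, smul_comm s z κ]
    abel
  by_cases hz : z = 0
  · subst hz
    have hg0 : g ≠ 0 := fun h0 => hg (h0 ▸ dvd_rfl)
    rw [zero_smul, zero_add] at hD
    have hβ := (smul_eq_zero.1 hD).resolve_left hg0
    obtain ⟨b, hb, -⟩ := hs.exact β 0 (by simp [hβ])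
    have hu : u ≠ 0 := hs.ne_zero.resolve_right (by simp)
    have : (s - g * b) • u = 0 := by
      rw [sub_smul, hsu', hb, zero_smul, zero_add, mul_smul, sub_self]
    have := sub_eq_zero.1 ((smul_eq_zero.1 this).resolve_right hu)
    rw [this]
    exact Ideal.mul_mem_right _ _ (Ideal.subset_span (by simp))
  · have hzp := prime_of_isHomogeneous_one hs.z_hom hz
    have hdvd : ∀ i, z ∣ (D *ᵥ β) i := by
      intro i
      have := congrFun hD i
      simp only [Pi.add_apply, Pi.smul_apply, smul_eq_mul, Pi.zero_apply] at this
      exact (hzp.dvd_or_dvd (Dvd.intro (-(D *ᵥ α + s • κ) i) (by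
        simp only [Pi.add_apply, Pi.smul_apply, smul_eq_mul]
        linear_combination -this))).resolve_left hg
    choose γ hγ using hdvd
    have hγ' : D *ᵥ β = z • γ := funext hγ
    have hγq : γ ⬝ᵥ q = 0 := by
      have := h.mulVec_dotProduct β
      rw [hγ', smul_dotProduct, smul_eq_mul] at this
      exact (mul_eq_zero.1 this).resolve_left hz
    obtain ⟨e, t, het⟩ := (h.exact _).1 hγq
    have h1 : D *ᵥ α + s • κ + g • γ = 0 := by
      rw [hγ', smul_comm, ← smul_add] at hD
      exact (smul_eq_zero.1 hD).resolve_left hz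
    obtain ⟨a, -, ha⟩ := hs.exact (α + g • e) (s + g * t) (by
      rw [← h1, het, mulVec_add, mulVec_smul, add_smul, smul_add, mul_smul]; abel)
    exact Ideal.mem_span_pair.2 ⟨a, -t, by linear_combination -ha⟩

end QuadricSyzygies

end Syzygies

/-! ### The rows of the linear syzygies modulo `z` -/

section Syzygies

open Matrix

variable {k : Type*} [Field k] {n : ℕ} {q : Fin 4 → MvPolynomial (Fin n) k}
  {D : Matrix (Fin 4) (Fin 3) (MvPolynomial (Fin n) k)} {κ : Fin 4 → MvPolynomial (Fin n) k}
  {u : Fin 3 → MvPolynomial (Fin n) k} {z : MvPolynomial (Fin n) k}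
  {ψ : MvPolynomial (Fin n) k →ₐ[k] MvPolynomial (Fin n) k}

lemma sum_fin_three_cyclic {M : Type*} [AddCommMonoid M] (f : Fin 3 → M) (i : Fin 3) :
    ∑ j, f j = f i + f (i + 1) + f (i + 2) := by
  rw [Fin.sum_univ_three]
  fin_cases i <;> simp <;> abel

namespace QuadricSyzygies

/-- If `u = z u'` with `z ≠ 0`, then `(u', 1)` is also a second syzygy, hence a multiple of `(u,
z)`, and the linear form `z` would be a unit. -/
lemma exists_map_ne_zero (hs : SecondSyzygy D κ u z) (hker : ∀ p, ψ p = 0 ↔ z ∣ p) :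
    ∃ j, ψ (u j) ≠ 0 := by
  by_contra! h0
  choose u' hu' using fun j => (hker _).1 (h0 j)
  have hu : u = z • u' := funext hu'
  by_cases hz : z = 0
  · rcases hs.ne_zero with h | h
    · exact h (by rw [hu, hz, zero_smul])
    · exact h hz
  have h1 : z • (D *ᵥ u' + (1 : MvPolynomial (Fin n) k) • κ) = 0 := by
    rw [one_smul, smul_add, ← mulVec_smul, ← hu, hs.rel]
  obtain ⟨s, -, hs1⟩ := hs.exact _ _ ((smul_eq_zero.1 h1).resolve_left hz)
  exact not_isUnit_of_isHomogeneous_one hs.z_hom (IsUnit.of_mul_eq_one_right _ hs1.symm)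

/-- The columns of `D` stay independent over `k` modulo `z`. If `D c = z v`, then `v` is a syzygy `D
e + t κ`, so `(c - z e, -z t)` is a multiple of `(u, z)`, and its constant term `c` vanishes. -/
lemma eq_zero_of_map_mulVec_eq_zero (h : QuadricSyzygies q D κ) (hs : SecondSyzygy D κ u z)
    (hker : ∀ p, ψ p = 0 ↔ z ∣ p) {c : Fin 3 → k}
    (hc : ∀ i, ψ ((D *ᵥ fun j => C (c j)) i) = 0) : c = 0 := by
  choose v hv using fun i => (hker _).1 (hc i)
  have hv' : (D *ᵥ fun j => C (c j)) = z • v := funext hv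
  by_cases hz : z = 0
  · exact h.indep c (by rw [hv', hz, zero_smul])
  have hvq : v ⬝ᵥ q = 0 := by
    have := h.mulVec_dotProduct fun j => C (c j)
    rw [hv', smul_dotProduct, smul_eq_mul] at this
    exact (mul_eq_zero.1 this).resolve_left hz
  obtain ⟨e, t, het⟩ := (h.exact _).1 hvq
  obtain ⟨s, hs1, -⟩ := hs.exact ((fun j => C (c j)) - z • e) (-(z * t)) (by
    rw [mulVec_sub, hv', het, mulVec_smul, smul_add, neg_smul, mul_smul]; abel)
  funext j
  have := congrArg constantCoeff (congrFun hs1 j)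
  simpa [constantCoeff_eq_zero_of_isHomogeneous hs.z_hom one_ne_zero,
    constantCoeff_eq_zero_of_isHomogeneous (hs.u_hom j) two_ne_zero] using this

lemma mem_span_of_map {s p g : MvPolynomial (Fin n) k} (hker : ∀ p, ψ p = 0 ↔ z ∣ p)
    (h : ψ p = ψ s * ψ g) : p ∈ Ideal.span {z, g} := by
  obtain ⟨r, hr⟩ := (hker (p - s * g)).1 (by rw [map_sub, map_mul, h, sub_self])
  exact Ideal.mem_span_pair.2 ⟨r, s, by linear_combination -hr⟩

lemma dvd_map_of_mem_span {p g : MvPolynomial (Fin n) k} (hker : ∀ p, ψ p = 0 ↔ z ∣ p)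
    (h : p ∈ Ideal.span {z, g}) : ψ g ∣ ψ p := by
  obtain ⟨a, b, rfl⟩ := Ideal.mem_span_pair.1 h
  rw [map_add, map_mul, map_mul, (hker z).2 dvd_rfl, mul_zero, zero_add]
  exact dvd_mul_left _ _

lemma sum_map_row (hs : SecondSyzygy D κ u z) (hker : ∀ p, ψ p = 0 ↔ z ∣ p) (i : Fin 4) :
    ∑ j, ψ (D i j) * ψ (u j) = 0 := by
  have := congrArg ψ (congrFun hs.rel i)
  simpa [mulVec, dotProduct, (hker z).2 dvd_rfl] using this

/-- The first three entries of the second syzygy are linearly independent modulo the last one. -/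
lemma u_indep (h : QuadricSyzygies q D κ) (hs : SecondSyzygy D κ u z)
    (hψ : ∀ p d, p.IsHomogeneous d → (ψ p).IsHomogeneous d) (hker : ∀ p, ψ p = 0 ↔ z ∣ p)
    {c : Fin 3 → k} (hc : ∑ j, C (c j) * ψ (u j) = 0) : c = 0 := by
  by_contra hne
  obtain ⟨i, hi⟩ := Function.ne_iff.1 hne
  rw [Pi.zero_apply] at hi
  set U := fun j => ψ (u j) with hU
  have hCi : (C (c i) : MvPolynomial (Fin n) k) ≠ 0 := by simpa using hi
  have hCu : (C (c i)⁻¹ * C (c i) : MvPolynomial (Fin n) k) = 1 := by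
    rw [← C_mul, inv_mul_cancel₀ hi, C_1]
  rw [sum_fin_three_cyclic _ i] at hc
  set α : Fin 4 → MvPolynomial (Fin n) k :=
    fun r => C (c i) * D r (i + 1) - C (c (i + 1)) * D r i with hα
  set β : Fin 4 → MvPolynomial (Fin n) k :=
    fun r => C (c i) * D r (i + 2) - C (c (i + 2)) * D r i with hβ
  have hCψ : ∀ a : k, ψ (C a) = C a := fun a => algHom_C ψ a
  -- The relation `c` eliminates `u i` from the orthogonality of row `r` to `u`.
  have hαβ : ∀ r, ψ (α r) * U (i + 1) + ψ (β r) * U (i + 2) = 0 := by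
    intro r
    have := sum_map_row hs hker r
    rw [sum_fin_three_cyclic _ i] at this
    simp only [hα, hβ, map_sub, map_mul, hCψ, hU]
    linear_combination C (c i) * this - ψ (D r i) * hc
  have hα0 : ∀ r, ψ (α r) = 0 := by
    intro r
    by_cases h2 : U (i + 2) = 0
    · have h1 : U (i + 1) ≠ 0 := by
        intro h1
        obtain ⟨j, hj⟩ := exists_map_ne_zero hs hker
        have h0 : U i = 0 := by
          simp only [hU] at h1 h2
          simpa [h1, h2, hi] using hc
        have : ∀ i : Fin 3, U i = 0 → U (i + 1) = 0 → U (i + 2) = 0 → U j = 0 := by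
          intro i
          fin_cases i <;> fin_cases j <;> simp +contextual
        exact hj (this i h0 h1 h2)
      have := hαβ r
      rw [h2, mul_zero, add_zero] at this
      exact (mul_eq_zero.1 this).resolve_right h1
    -- Here `α r` multiplies all of `u` into `(z, u (i + 2))`, hence lies in it; a linear form
    -- divisible by a quadric modulo `z` is zero there.
    · have hαh : (α r).IsHomogeneous 1 := ((h.D_hom _ _).C_mul _).sub ((h.D_hom _ _).C_mul _)
      refine eq_zero_of_dvd (hψ _ _ hαh) (hψ _ _ (hs.u_hom (i + 2))) one_lt_two
        (dvd_map_of_mem_span hker (h.mem_of_forall_mul_mem hs (fun h0 => h2 ((hker _).2 h0)) ?_))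
      have m1 : α r * u (i + 1) ∈ Ideal.span {z, u (i + 2)} :=
        mem_span_of_map hker (s := -β r) (by
          have := hαβ r
          rw [map_mul, map_neg]
          linear_combination this)
      have m2 : α r * u (i + 2) ∈ Ideal.span {z, u (i + 2)} :=
        Ideal.mul_mem_left _ _ (Ideal.subset_span (by simp))
      have m0 : α r * u i ∈ Ideal.span {z, u (i + 2)} :=
        mem_span_of_map hker (s := C (c i)⁻¹ * (C (c (i + 1)) * β r - C (c (i + 2)) * α r)) (by
          have := hαβ r
          simp only [map_mul, map_sub, hCψ]
          simp only [hU] at this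
          linear_combination C (c i)⁻¹ * ψ (α r) * hc - C (c i)⁻¹ * C (c (i + 1)) * this -
            ψ (α r) * ψ (u i) * hCu)
      have : ∀ i : Fin 3, ∀ P : Fin 3 → Prop, P i → P (i + 1) → P (i + 2) → ∀ j, P j := by
        intro i P h0 h1 h2 j
        fin_cases i <;> fin_cases j <;> assumption
      exact this i (fun j => α r * u j ∈ Ideal.span {z, u (i + 2)}) m0 m1 m2
  -- The vector `α` is a combination of two columns of `D` with constant coefficients, one of them
  -- `c i ≠ 0`.
  have := h.eq_zero_of_map_mulVec_eq_zero hs hker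
    (c := Pi.single (i + 1) (c i) - Pi.single i (c (i + 1))) (fun r => by
      rw [← hα0 r]
      congr 1
      simp [mulVec, dotProduct, hα, mul_sub, Finset.sum_sub_distrib, Pi.single_apply,
        apply_ite (C : k → MvPolynomial (Fin n) k), mul_comm])
  have := congrFun this (i + 1)
  have hne : i + 1 ≠ i := by fin_cases i <;> decide
  simp [hne] at this
  exact hi this

/-- Two parallel vectors of linear forms orthogonal to `u` are proportional over `k`. -/
lemma exists_eq_C_smul_of_cross_eq_zero (h : QuadricSyzygies q D κ) (hs : SecondSyzygy D κ u z)
    (hψ : ∀ p d, p.IsHomogeneous d → (ψ p).IsHomogeneous d) (hker : ∀ p, ψ p = 0 ↔ z ∣ p)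
    {r r' : Fin 3 → MvPolynomial (Fin n) k} (hr : ∀ j, (r j).IsHomogeneous 1)
    (hr' : ∀ j, (r' j).IsHomogeneous 1) (hru : ∑ j, r j * ψ (u j) = 0) (hr0 : r ≠ 0)
    (hrr : crossProduct r r' = 0) : ∃ t : k, r' = (C t : MvPolynomial (Fin n) k) • r := by
  have hmin : ∀ i j, r i * r' j = r j * r' i := by
    have h0 := congrFun hrr 0
    have h1 := congrFun hrr 1
    have h2 := congrFun hrr 2
    simp [cross_apply] at h0 h1 h2
    intro i j
    fin_cases i <;> fin_cases j <;> simp <;> first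
      | linear_combination h0 | linear_combination h1 | linear_combination h2
      | linear_combination -h0 | linear_combination -h1 | linear_combination -h2
  obtain ⟨i, hi⟩ := Function.ne_iff.1 hr0
  rw [Pi.zero_apply] at hi
  have hp := prime_of_isHomogeneous_one (hr i) hi
  by_cases hdvd : r i ∣ r' i
  · obtain ⟨t, ht⟩ := exists_eq_C_mul_of_dvd (hr' i) (hr i) hdvd
    refine ⟨t, funext fun j => mul_left_cancel₀ hi ?_⟩
    rw [hmin, ht, Pi.smul_apply, smul_eq_mul]
    ring
  -- The prime `r i` divides every `r j`, so `r` is `r i` times a constant vector, and that vector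
  -- is orthogonal to `u`.
  · exfalso
    have : ∀ j, ∃ c : k, r j = C c * r i := fun j =>
      exists_eq_C_mul_of_dvd (hr j) (hr i)
        ((hp.dvd_or_dvd (Dvd.intro _ (hmin i j))).resolve_right hdvd)
    choose c hc using this
    have hcu : ∑ j, C (c j) * ψ (u j) = 0 := by
      refine mul_left_cancel₀ hi ?_
      rw [mul_zero, ← hru, Finset.mul_sum]
      refine Finset.sum_congr rfl fun j _ => ?_
      rw [hc j]; ring
    have hc0 := h.u_indep hs hψ hker hcu
    apply hi
    rw [hc i, hc0]
    simp

/-- The cross product of two rows is a constant multiple of `u`. -/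
lemma exists_cross_eq (h : QuadricSyzygies q D κ) (hs : SecondSyzygy D κ u z)
    (hψ : ∀ p d, p.IsHomogeneous d → (ψ p).IsHomogeneous d) (hker : ∀ p, ψ p = 0 ↔ z ∣ p)
    (i i' : Fin 4) : ∃ c : k, crossProduct (fun j => ψ (D i j)) (fun j => ψ (D i' j)) =
      (C c : MvPolynomial (Fin n) k) • fun j => ψ (u j) := by
  set w := crossProduct (D i) (D i') with hw
  have hwψ : crossProduct (fun j => ψ (D i j)) (fun j => ψ (D i' j)) = fun j => ψ (w j) := by
    funext j
    fin_cases j <;> simp [hw, cross_apply]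
  have hwh : ∀ j, (w j).IsHomogeneous 2 := by
    have : ∀ a b, (D i a * D i' b).IsHomogeneous 2 := fun a b =>
      (h.D_hom i a).mul (h.D_hom i' b)
    intro j
    fin_cases j
    all_goals simp only [hw, cross_apply]; exact (this _ _).sub (this _ _)
  have hmin : ∀ a b, ψ (w a) * ψ (u b) = ψ (w b) * ψ (u a) := by
    have h1 := sum_map_row hs hker i
    have h2 := sum_map_row hs hker i'
    rw [Fin.sum_univ_three] at h1 h2
    have e01 : ψ (w 0) * ψ (u 1) = ψ (w 1) * ψ (u 0) := by
      simp [hw, cross_apply]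
      linear_combination ψ (D i' 2) * h1 - ψ (D i 2) * h2
    have e02 : ψ (w 0) * ψ (u 2) = ψ (w 2) * ψ (u 0) := by
      simp [hw, cross_apply]
      linear_combination -ψ (D i' 1) * h1 + ψ (D i 1) * h2
    have e12 : ψ (w 1) * ψ (u 2) = ψ (w 2) * ψ (u 1) := by
      simp [hw, cross_apply]
      linear_combination ψ (D i' 0) * h1 - ψ (D i 0) * h2
    intro a b
    fin_cases a <;> fin_cases b
    exacts [rfl, e01, e02, e01.symm, rfl, e12, e02.symm, e12.symm, rfl]
  obtain ⟨a, ha⟩ := exists_map_ne_zero hs hker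
  -- Both `w` and `u` are orthogonal to the two rows modulo `z`, so they are parallel and `w a`
  -- multiplies `u` into `(z, u a)`. Both entries are quadrics, whence the constant factor.
  have hmem : w a ∈ Ideal.span {z, u a} :=
    h.mem_of_forall_mul_mem hs (fun h0 => ha ((hker _).2 h0)) fun b =>
      mem_span_of_map hker (s := w b) (by rw [map_mul, hmin])
  obtain ⟨c, hc⟩ := exists_eq_C_mul_of_dvd (hψ _ _ (hwh a)) (hψ _ _ (hs.u_hom a))
    (dvd_map_of_mem_span hker hmem)
  refine ⟨c, hwψ.trans (funext fun b => mul_right_cancel₀ ha ?_)⟩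
  rw [hmin, hc, Pi.smul_apply, smul_eq_mul]
  ring

/-- The rows of `D` modulo `z` span a space of dimension at most two. -/
lemma exists_rows_mem_span (h : QuadricSyzygies q D κ) (hs : SecondSyzygy D κ u z)
    (hψ : ∀ p d, p.IsHomogeneous d → (ψ p).IsHomogeneous d) (hker : ∀ p, ψ p = 0 ↔ z ∣ p) :
    ∃ i i' : Fin 4, ∀ l, (fun j => ψ (D l j)) ∈
      Submodule.span k {(fun j => ψ (D i j)), fun j => ψ (D i' j)} := by
  set R : Fin 4 → Fin 3 → MvPolynomial (Fin n) k := fun i j => ψ (D i j) with hR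
  have hRh : ∀ i j, (R i j).IsHomogeneous 1 := fun i j => hψ _ _ (h.D_hom i j)
  have hRu : ∀ i, ∑ j, R i j * ψ (u j) = 0 := sum_map_row hs hker
  have hCs : ∀ (c : k) (v : Fin 3 → MvPolynomial (Fin n) k),
      (C c : MvPolynomial (Fin n) k) • v = c • v := fun c v => by
    funext j; simp [smul_eq_C_mul]
  choose c hc using h.exists_cross_eq hs hψ hker
  by_cases hcross : ∀ i i', crossProduct (R i) (R i') = 0
  · have : ∃ i, R i ≠ 0 := by
      by_contra! h0
      have := h.eq_zero_of_map_mulVec_eq_zero hs hker (c := Pi.single 0 1) (fun i => by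
        have : ψ (D i 0) = 0 := congrFun (h0 i) 0
        simpa [mulVec, dotProduct, Pi.single_apply,
          apply_ite (C : k → MvPolynomial (Fin n) k)] using this)
      simpa using congrFun this 0
    obtain ⟨i, hi⟩ := this
    refine ⟨i, i, fun l => ?_⟩
    obtain ⟨t, ht⟩ := h.exists_eq_C_smul_of_cross_eq_zero hs hψ hker (hRh i) (hRh l) (hRu i) hi
      (hcross i l)
    change R l ∈ _
    rw [ht, hCs]
    exact Submodule.smul_mem _ _ (Submodule.subset_span (by simp [hR]))
  · push Not at hcross
    obtain ⟨i, i', hii⟩ := hcross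
    have hc0 : c i i' ≠ 0 := by
      intro h0
      apply hii
      have := hc i i'
      rw [h0, C_0, zero_smul] at this
      exact this
    refine ⟨i, i', fun l => ?_⟩
    have hcc : ∀ a b, crossProduct (R a) (R b) = c a b • fun j => ψ (u j) := fun a b => by
      rw [← hCs]; exact hc a b
    -- The coefficients are those for which the cross products of `r` with `R i` and `R i'` vanish.
    -- Were `r` nonzero, both rows would be scalar multiples of it and parallel.
    set r := R l - (c l i' / c i i') • R i - (c i l / c i i') • R i' with hr
    have hrh : ∀ j, (r j).IsHomogeneous 1 := fun j => by
      simp only [hr, Pi.sub_apply, Pi.smul_apply, smul_eq_C_mul]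
      exact ((hRh l j).sub ((hRh i j).C_mul _)).sub ((hRh i' j).C_mul _)
    have hru : ∑ j, r j * ψ (u j) = 0 := by
      have e : ∑ j, r j * ψ (u j) = ∑ j, R l j * ψ (u j) -
          (c l i' / c i i') • ∑ j, R i j * ψ (u j) - (c i l / c i i') • ∑ j, R i' j * ψ (u j) := by
        simp only [Finset.smul_sum, ← Finset.sum_sub_distrib]
        refine Finset.sum_congr rfl fun j _ => ?_
        simp only [hr, Pi.sub_apply, Pi.smul_apply, smul_eq_C_mul]
        ring
      rw [e, hRu, hRu, hRu]
      simp
    have hsm : ∀ (a : k) (v w : Fin 3 → MvPolynomial (Fin n) k),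
        crossProduct (a • v) w = a • crossProduct v w := fun a v w => by
      rw [← hCs, ← hCs, map_smul, LinearMap.smul_apply]
    have hx1 : crossProduct r (R i') = 0 := by
      rw [hr, map_sub, map_sub, LinearMap.sub_apply, LinearMap.sub_apply, hsm, hsm, cross_self,
        hcc, hcc, smul_smul, div_mul_cancel₀ _ hc0]
      simp
    have hx2 : crossProduct r (R i) = 0 := by
      have e : crossProduct (R l) (R i) = -(c i l • fun j => ψ (u j)) := by
        rw [← hcc, cross_anticomm]
      have e' : crossProduct (R i') (R i) = -(c i i' • fun j => ψ (u j)) := by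
        rw [← hcc, cross_anticomm]
      rw [hr, map_sub, map_sub, LinearMap.sub_apply, LinearMap.sub_apply, hsm, hsm, cross_self,
        e, e', smul_neg, smul_smul, div_mul_cancel₀ _ hc0]
      simp
    have hr0 : r = 0 := by
      by_contra hr0
      obtain ⟨t, ht⟩ := h.exists_eq_C_smul_of_cross_eq_zero hs hψ hker hrh (hRh i) hru hr0 hx2
      obtain ⟨t', ht'⟩ := h.exists_eq_C_smul_of_cross_eq_zero hs hψ hker hrh (hRh i') hru hr0 hx1
      apply hii
      rw [ht, ht', map_smul, LinearMap.map_smul₂, cross_self]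
      simp
    have hl : R l = (c l i' / c i i') • R i + (c i l / c i i') • R i' := by
      rw [hr, sub_sub, sub_eq_zero] at hr0
      exact hr0
    change R l ∈ _
    rw [hl]
    exact add_mem (Submodule.smul_mem _ _ (Submodule.subset_span (by simp [hR])))
      (Submodule.smul_mem _ _ (Submodule.subset_span (by simp [hR])))

end QuadricSyzygies

end Syzygies

/-! ### Normal form of the syzygy matrix -/

section Syzygies

open Matrix

variable {k : Type*} [Field k] {n : ℕ} {q : Fin 4 → MvPolynomial (Fin n) k}
  {D : Matrix (Fin 4) (Fin 3) (MvPolynomial (Fin n) k)} {κ : Fin 4 → MvPolynomial (Fin n) k}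
  {u : Fin 3 → MvPolynomial (Fin n) k} {z : MvPolynomial (Fin n) k}

/-- An independent family of vectors of `k ^ m` consists of the rows of an invertible matrix. -/
lemma exists_inverse_of_linearIndependent {m : ℕ} {P : Matrix (Fin m) (Fin m) k}
    (h : LinearIndependent k P.row) : ∃ P', P * P' = 1 ∧ P' * P = 1 := by
  obtain ⟨U, rfl⟩ := Matrix.linearIndependent_rows_iff_isUnit.1 h
  exact ⟨↑U⁻¹, U.mul_inv, U.inv_mul⟩

namespace QuadricSyzygies

/-- Four rows in a space of dimension at most two satisfy two independent constant relations modulo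
`z`; these become the last two rows of `P`. -/
lemma exists_row_change (h : QuadricSyzygies q D κ) (hs : SecondSyzygy D κ u z) :
    ∃ P P' : Matrix (Fin 4) (Fin 4) k, P * P' = 1 ∧ P' * P = 1 ∧
      ∀ j, z ∣ (constMatrix n P * D) 2 j ∧ z ∣ (constMatrix n P * D) 3 j := by
  obtain ⟨ψ, hψ, hker, -⟩ := exists_retraction hs.z_hom
  obtain ⟨i, i', hii⟩ := h.exists_rows_mem_span hs hψ hker
  set R : Fin 4 → Fin 3 → MvPolynomial (Fin n) k := fun i j => ψ (D i j) with hR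
  set ρ := Fintype.linearCombination k R with hρ
  have hrange : Module.finrank k (LinearMap.range ρ) ≤ 2 := by
    have hle : LinearMap.range ρ ≤ Submodule.span k (Set.range ![R i, R i']) := by
      rw [Fintype.range_linearCombination, Submodule.span_le]
      rintro _ ⟨l, rfl⟩
      have := hii l
      rwa [SetLike.mem_coe, Matrix.range_cons, Matrix.range_cons, Matrix.range_empty,
        Set.union_empty]
    have := FiniteDimensional.span_of_finite k (Set.finite_range ![R i, R i'])
    refine (Submodule.finrank_mono hle).trans ?_
    exact (finrank_range_le_card (R := k) ![R i, R i']).trans (by simp)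
  have hkerdim : 2 ≤ Module.finrank k (LinearMap.ker ρ) := by
    have := ρ.finrank_range_add_finrank_ker
    rw [Module.finrank_fin_fun] at this
    omega
  obtain ⟨c', hc'⟩ := exists_linearIndependent_cons_of_lt_finrank
    (v := (![] : Fin 0 → LinearMap.ker ρ)) linearIndependent_empty_type (Nat.lt_of_lt_of_le two_pos hkerdim)
  obtain ⟨c, hc⟩ := exists_linearIndependent_cons_of_lt_finrank hc'
    (Nat.lt_of_lt_of_le one_lt_two hkerdim)
  have h2 : LinearIndependent k (![(c : Fin 4 → k), (c' : Fin 4 → k)]) := by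
    have hcc : (LinearMap.ker ρ).subtype ∘ Fin.cons c (Fin.cons c' ![]) =
        ![(c : Fin 4 → k), (c' : Fin 4 → k)] := by
      funext l; fin_cases l <;> rfl
    exact hcc ▸ hc.map' (LinearMap.ker ρ).subtype (Submodule.ker_subtype _)
  obtain ⟨b, hb⟩ := exists_linearIndependent_cons_of_lt_finrank h2 (by simp)
  obtain ⟨a, ha⟩ := exists_linearIndependent_cons_of_lt_finrank hb (by simp)
  obtain ⟨P', hP, hP'⟩ := exists_inverse_of_linearIndependent
    (P := Matrix.of (Fin.cons a (Fin.cons b ![(c : Fin 4 → k), (c' : Fin 4 → k)]))) ha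
  refine ⟨_, P', hP, hP', fun j => ?_⟩
  have key : ∀ c ∈ LinearMap.ker ρ, z ∣ ∑ l, C (c l) * D l j := by
    intro c hc
    rw [← hker]
    have := congrFun (LinearMap.mem_ker.1 hc) j
    simpa [hρ, Fintype.linearCombination_apply, hR, smul_eq_C_mul, algHom_C, algebraMap_eq]
      using this
  exact ⟨key c c.2, key c' c'.2⟩

/-- The shape of the syzygy matrix in suitable bases. -/
structure NormalForm (q : Fin 4 → MvPolynomial (Fin n) k)
    (D : Matrix (Fin 4) (Fin 3) (MvPolynomial (Fin n) k)) (z : MvPolynomial (Fin n) k) : Prop where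
  z_ne_zero : z ≠ 0
  D20 : D 2 0 = 0
  D30 : D 3 0 = 0
  D21 : D 2 1 = z
  D31 : D 3 1 = 0
  D22 : D 2 2 = 0
  D32 : D 3 2 = z

lemma q_ne_zero (h : QuadricSyzygies q D κ) (i : Fin 4) : q i ≠ 0 := by
  intro h0
  have := h.q_indep (Pi.single i 1) (by
    simp [dotProduct, Pi.single_apply, apply_ite (C : k → MvPolynomial (Fin n) k), h0])
  simpa using congrFun this i

/-- Linear relations between two of the quadrics form a space of dimension at most one. -/
lemma exists_eq_smul_of_rows_eq_zero (h : QuadricSyzygies q D κ) {v v' : Fin 3 → k} (hv : v ≠ 0)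
    (hv2 : (D *ᵥ fun j => C (v j)) 2 = 0) (hv3 : (D *ᵥ fun j => C (v j)) 3 = 0)
    (hv2' : (D *ᵥ fun j => C (v' j)) 2 = 0) (hv3' : (D *ᵥ fun j => C (v' j)) 3 = 0) :
    ∃ t : k, v' = t • v := by
  set w := D *ᵥ fun j => C (v j) with hw
  set w' := D *ᵥ fun j => C (v' j) with hw'
  have hD1 : ∀ (v : Fin 3 → k) i, ((D *ᵥ fun j => C (v j)) i).IsHomogeneous 1 := fun v i =>
    IsHomogeneous.sum _ _ _ fun j _ => by
      rw [mul_comm]; exact (h.D_hom i j).C_mul _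
  have e : w 0 * q 0 + w 1 * q 1 = 0 := by
    have := h.mulVec_dotProduct fun j => C (v j)
    rw [← hw] at this
    simpa [dotProduct, Fin.sum_univ_four, hv2, hv3] using this
  have e' : w' 0 * q 0 + w' 1 * q 1 = 0 := by
    have := h.mulVec_dotProduct fun j => C (v' j)
    rw [← hw'] at this
    simpa [dotProduct, Fin.sum_univ_four, hv2', hv3'] using this
  have q0 := h.q_ne_zero 0
  have q1 := h.q_ne_zero 1
  have hw0 : w 0 ≠ 0 := by
    intro h0
    rw [h0, zero_mul, zero_add] at e
    have h1 := (mul_eq_zero.1 e).resolve_right q1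
    refine hv (h.indep v (funext fun i => ?_))
    fin_cases i
    exacts [h0, h1, hv2, hv3]
  -- Divisibility would make `q 0` and `q 1` dependent over `k`. So `w 0` and `w 1` are coprime and
  -- `w` is, up to a scalar, the only linear relation between these two quadrics.
  have hndvd : ¬ w 0 ∣ w 1 := by
    intro hd
    obtain ⟨t, ht⟩ := exists_eq_C_mul_of_dvd (hD1 v 1) (hD1 v 0) hd
    rw [← hw] at ht
    have h0 : q 0 + C t * q 1 = 0 := mul_left_cancel₀ hw0 (by
      rw [mul_zero, ← e, ht]; ring)
    have := h.q_indep ![1, t, 0, 0] (by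
      simpa [dotProduct, Fin.sum_univ_four] using h0)
    simpa using congrFun this 0
  have hcr : w 0 * w' 1 = w' 0 * w 1 := mul_right_cancel₀ q1 (by
    linear_combination w 0 * e' - w' 0 * e)
  have hp := prime_of_isHomogeneous_one (hD1 v 0) hw0
  have hd : w 0 ∣ w' 0 := (hp.dvd_or_dvd (Dvd.intro _ hcr)).resolve_right hndvd
  obtain ⟨t, ht⟩ := exists_eq_C_mul_of_dvd (hD1 v' 0) (hD1 v 0) hd
  rw [← hw, ← hw'] at ht
  have ht1 : w' 1 = C t * w 1 := mul_left_cancel₀ hw0 (by rw [hcr, ht]; ring)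
  refine ⟨t, sub_eq_zero.1 (h.indep _ ?_)⟩
  have : (fun j => C ((v' - t • v) j) : Fin 3 → MvPolynomial (Fin n) k) =
      (fun j => C (v' j)) - (C t : MvPolynomial (Fin n) k) • fun j => C (v j) := by
    funext j; simp
  rw [this, mulVec_sub, mulVec_smul, ← hw, ← hw']
  funext i
  fin_cases i
  · simp [ht]
  · simp [ht1]
  · simp [hv2, hv2']
  · simp [hv3, hv3']

/-- By degrees the last two rows are `z` times a constant 2 × 3 matrix `ν`. Its kernel has dimension
one, as it yields linear relations between `q 0` and `q 1` only, so `ν` is surjective; the new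
columns are a kernel vector and preimages of the two unit vectors. -/
lemma exists_col_change (h : QuadricSyzygies q D κ) (hz : z.IsHomogeneous 1)
    (hD : ∀ j, z ∣ D 2 j ∧ z ∣ D 3 j) :
    ∃ Q Q' : Matrix (Fin 3) (Fin 3) k, Q * Q' = 1 ∧ Q' * Q = 1 ∧
      NormalForm q (D * constMatrix n Q) z := by
  choose a ha using fun j => exists_eq_C_mul_of_dvd (h.D_hom 2 j) hz (hD j).1
  choose b hb using fun j => exists_eq_C_mul_of_dvd (h.D_hom 3 j) hz (hD j).2
  let ν : (Fin 3 → k) →ₗ[k] (Fin 2 → k) := Matrix.mulVecLin (Matrix.of ![a, b])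
  have hν2 : ∀ v, (D *ᵥ fun j => C (v j)) 2 = C (ν v 0) * z := by
    intro v
    simp [ν, mulVec, dotProduct, ha, Fin.sum_univ_three]
    ring
  have hν3 : ∀ v, (D *ᵥ fun j => C (v j)) 3 = C (ν v 1) * z := by
    intro v
    simp [ν, mulVec, dotProduct, hb, Fin.sum_univ_three]
    ring
  have hrank := ν.finrank_range_add_finrank_ker
  rw [Module.finrank_fin_fun] at hrank
  have hrange : Module.finrank k (LinearMap.range ν) ≤ 2 := by
    simpa using Submodule.finrank_le (LinearMap.range ν)
  obtain ⟨v₁, hv₁, hv₁0⟩ := (LinearMap.ker ν).exists_mem_ne_zero_of_ne_bot (fun h0 => by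
    rw [h0, finrank_bot] at hrank; omega)
  rw [LinearMap.mem_ker] at hv₁
  have hker : ∀ v, ν v = 0 → ∃ t : k, v = t • v₁ := fun v hv =>
    h.exists_eq_smul_of_rows_eq_zero hv₁0 (by simp [hν2, hv₁]) (by simp [hν3, hv₁])
      (by simp [hν2, hv]) (by simp [hν3, hv])
  have hkerdim : Module.finrank k (LinearMap.ker ν) ≤ 1 := by
    refine finrank_le_one ⟨v₁, hv₁⟩ fun w => ?_
    obtain ⟨t, ht⟩ := hker w w.2
    exact ⟨t, Subtype.ext ht.symm⟩
  have hsurj : Function.Surjective ν := by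
    rw [← LinearMap.range_eq_top]
    refine Submodule.eq_top_of_finrank_eq ?_
    rw [Module.finrank_fin_fun]
    omega
  obtain ⟨v₂, hv₂⟩ := hsurj ![1, 0]
  obtain ⟨v₃, hv₃⟩ := hsurj ![0, 1]
  have hz0 : z ≠ 0 := by
    intro hz0
    obtain ⟨t, ht⟩ := h.exists_eq_smul_of_rows_eq_zero (v' := v₂) hv₁0 (by simp [hν2, hv₁])
      (by simp [hν3, hv₁]) (by simp [hν2, hz0]) (by simp [hν3, hz0])
    rw [ht, map_smul, hv₁] at hv₂
    simpa using congrFun hv₂ 0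
  have hindep : LinearIndependent k (Matrix.of ![v₁, v₂, v₃]).row := by
    rw [Fintype.linearIndependent_iff]
    intro c hc
    have hc' : c 0 • v₁ + c 1 • v₂ + c 2 • v₃ = 0 := by
      simpa [Fin.sum_univ_three] using hc
    have := congrArg ν hc'
    simp only [map_add, map_smul, hv₁, hv₂, hv₃] at this
    have h1 : c 1 = 0 := by simpa using congrFun this 0
    have h2 : c 2 = 0 := by simpa using congrFun this 1
    have h0 : c 0 = 0 := by
      rw [h1, h2] at hc'
      simpa [hv₁0] using hc'
    intro i
    fin_cases i
    exacts [h0, h1, h2]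
  obtain ⟨Q', hQ, hQ'⟩ := exists_inverse_of_linearIndependent hindep
  have hcol : ∀ i j, (D * constMatrix n (Matrix.of ![v₁, v₂, v₃])ᵀ) i j =
      (D *ᵥ fun l => C (![v₁, v₂, v₃] j l)) i := fun i j => rfl
  refine ⟨(Matrix.of ![v₁, v₂, v₃])ᵀ, Q'ᵀ, ?_, ?_, hz0, ?_, ?_, ?_, ?_, ?_, ?_⟩
  · rw [← Matrix.transpose_mul, hQ', Matrix.transpose_one]
  · rw [← Matrix.transpose_mul, hQ, Matrix.transpose_one]
  · rw [hcol]; simp [hν2, hv₁]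
  · rw [hcol]; simp [hν3, hv₁]
  · rw [hcol]; simp [hν2, hv₂]
  · rw [hcol]; simp [hν3, hv₂]
  · rw [hcol]; simp [hν2, hv₃]
  · rw [hcol]; simp [hν3, hv₃]

/-- In the normal form the ideal of the quadrics is `(xz, yz, ax + by, cx + dy)`. -/
lemma NormalForm.exists_eq (h : QuadricSyzygies q D κ) (hN : NormalForm q D z)
    (hz : z.IsHomogeneous 1) :
    ∃ (x y : MvPolynomial (Fin n) k) (t : k), x.IsHomogeneous 1 ∧ y.IsHomogeneous 1 ∧ t ≠ 0 ∧
      q 0 = x * z ∧ q 1 = y * z ∧ D 0 0 = C t * y ∧ D 1 0 = -(C t * x) ∧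
      q 2 = -(D 0 1 * x + D 1 1 * y) ∧ q 3 = -(D 0 2 * x + D 1 2 * y) := by
  have hcol : ∀ j, D 0 j * q 0 + D 1 j * q 1 + D 2 j * q 2 + D 3 j * q 3 = 0 := by
    intro j
    have := h.mulVec_dotProduct (Pi.single j 1)
    simpa [dotProduct, Fin.sum_univ_four] using this
  have e0 := hcol 0
  have e1 := hcol 1
  have e2 := hcol 2
  rw [hN.D20, hN.D30] at e0
  rw [hN.D21, hN.D31] at e1
  rw [hN.D22, hN.D32] at e2
  have q0 := h.q_ne_zero 0
  have q1 := h.q_ne_zero 1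
  have hα0 : D 0 0 ≠ 0 := by
    intro h0
    have h1 : D 1 0 = 0 := (mul_eq_zero.1 (show D 1 0 * q 1 = 0 by
      rw [h0] at e0; linear_combination e0)).resolve_right q1
    have := h.indep (Pi.single 0 1) (by
      funext i
      simp [mulVec, dotProduct, Pi.single_apply, apply_ite (C : k → MvPolynomial (Fin n) k)]
      fin_cases i
      exacts [h0, h1, hN.D20, hN.D30])
    simpa using congrFun this 0
  have hndvd : ¬ D 0 0 ∣ D 1 0 := by
    intro hd
    obtain ⟨t, ht⟩ := exists_eq_C_mul_of_dvd (h.D_hom 1 0) (h.D_hom 0 0) hd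
    have h0 : q 0 + C t * q 1 = 0 := mul_left_cancel₀ hα0 (by
      rw [ht] at e0; linear_combination e0)
    have := h.q_indep ![1, t, 0, 0] (by
      simpa [dotProduct, Fin.sum_univ_four] using h0)
    simpa using congrFun this 0
  have hp := prime_of_isHomogeneous_one (h.D_hom 0 0) hα0
  have hd : D 0 0 ∣ q 1 := (hp.dvd_or_dvd (Dvd.intro (-q 0) (by
    linear_combination -e0))).resolve_left hndvd
  obtain ⟨m, hm, hq1⟩ := exists_eq_mul_of_dvd (e := 1) (h.q_hom 1) (h.D_hom 0 0) hd
  have hq0 : q 0 = -(D 1 0 * m) := mul_left_cancel₀ hα0 (by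
    rw [hq1] at e0; linear_combination e0)
  have hm0 : m ≠ 0 := by rintro rfl; exact q1 (by rw [hq1, mul_zero])
  have hmp := prime_of_isHomogeneous_one hm hm0
  -- Otherwise columns 1 and 2 force `m` to divide `q 2` and `q 3`. The cofactors give the linear
  -- syzygy `(0, 0, l3, -l2)`, so they are constant multiples of `z`, and `q 2`, `q 3` would be
  -- dependent.
  have hmz : m ∣ z := by
    by_contra hmz
    have d2 : m ∣ q 2 := (hmp.dvd_or_dvd (Dvd.intro (D 0 1 * D 1 0 - D 1 1 * D 0 0) (by
      rw [hq0, hq1] at e1; linear_combination -e1) : m ∣ z * q 2)).resolve_left hmz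
    have d3 : m ∣ q 3 := (hmp.dvd_or_dvd (Dvd.intro (D 0 2 * D 1 0 - D 1 2 * D 0 0) (by
      rw [hq0, hq1] at e2; linear_combination -e2) : m ∣ z * q 3)).resolve_left hmz
    obtain ⟨l2, hl2, hq2⟩ := exists_eq_mul_of_dvd (e := 1) (h.q_hom 2) hm d2
    obtain ⟨l3, hl3, hq3⟩ := exists_eq_mul_of_dvd (e := 1) (h.q_hom 3) hm d3
    obtain ⟨c, hc⟩ := h.exists_of_isHomogeneous_one (v := ![0, 0, l3, -l2]) (by
      intro i; fin_cases i
      exacts [isHomogeneous_zero _ _ _, isHomogeneous_zero _ _ _, hl3, hl2.neg]) (by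
      simp [dotProduct, Fin.sum_univ_four, hq2, hq3]; ring)
    have c2 : l3 = z * C (c 1) := by
      have := congrFun hc 2
      simpa [mulVec, dotProduct, Fin.sum_univ_three, hN.D20, hN.D21, hN.D22] using this
    have c3 : -l2 = z * C (c 2) := by
      have := congrFun hc 3
      simpa [mulVec, dotProduct, Fin.sum_univ_three, hN.D30, hN.D31, hN.D32] using this
    have hc0 := h.q_indep ![0, 0, c 1, c 2] (by
      simp [dotProduct, Fin.sum_univ_four]
      rw [hq2, hq3]
      linear_combination C (c 2) * m * c2 - C (c 1) * m * c3)
    have hc1 : c 1 = 0 := by simpa using congrFun hc0 2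
    rw [hc1, C_0, mul_zero] at c2
    exact h.q_ne_zero 3 (by rw [hq3, c2, mul_zero])
  obtain ⟨t, ht⟩ := exists_eq_C_mul_of_dvd hz hm hmz
  have ht0 : t ≠ 0 := by
    rintro rfl
    exact hN.z_ne_zero (by rw [ht, C_0, zero_mul])
  have hCt : (C t⁻¹ * C t : MvPolynomial (Fin n) k) = 1 := by
    rw [← C_mul, inv_mul_cancel₀ ht0, C_1]
  have hx : q 0 = -(C t⁻¹ * D 1 0) * z := by
    rw [hq0, ht]; linear_combination D 1 0 * m * hCt
  have hy : q 1 = C t⁻¹ * D 0 0 * z := by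
    rw [hq1, ht]; linear_combination -(D 0 0 * m * hCt)
  refine ⟨-(C t⁻¹ * D 1 0), C t⁻¹ * D 0 0, t, ((h.D_hom 1 0).C_mul _).neg, (h.D_hom 0 0).C_mul _,
    ht0, hx, hy, by linear_combination -(D 0 0 * hCt), by linear_combination -(D 1 0 * hCt),
    mul_left_cancel₀ hN.z_ne_zero ?_, mul_left_cancel₀ hN.z_ne_zero ?_⟩
  · rw [hx, hy] at e1; linear_combination e1
  · rw [hx, hy] at e2; linear_combination e2

/-- Every syzygy is a combination of the linear ones and the Koszul syzygy of `q 2` and `q 3`. -/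
lemma NormalForm.exists_koszul (h : QuadricSyzygies q D κ) (hN : NormalForm q D z)
    {v : Fin 4 → MvPolynomial (Fin n) k} (hv : v ⬝ᵥ q = 0) :
    ∃ (e : Fin 3 → MvPolynomial (Fin n) k) (s : MvPolynomial (Fin n) k),
      v = D *ᵥ e + s • ![0, 0, -q 3, q 2] := by
  obtain ⟨ℓ, c, hℓ, hc⟩ := h.exists_of_isHomogeneous_two (v := ![0, 0, -q 3, q 2]) (by
    intro i; fin_cases i
    exacts [isHomogeneous_zero _ _ _, isHomogeneous_zero _ _ _, (h.q_hom 3).neg, h.q_hom 2]) (by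
    simp [dotProduct, Fin.sum_univ_four]; ring)
  -- If `c = 0`, then `z` divides `q 2` and `q 3`, and their cofactors form a linear syzygy `(0, 0,
  -- ℓ 1, ℓ 2)`, again with entries in `k z`, contradicting independence. So `κ` can be solved for.
  have hc0 : c ≠ 0 := by
    rintro rfl
    have c2 : -q 3 = z * ℓ 1 := by
      have := congrFun hc 2
      simpa [mulVec, dotProduct, Fin.sum_univ_three, hN.D20, hN.D21, hN.D22] using this
    have c3 : q 2 = z * ℓ 2 := by
      have := congrFun hc 3
      simpa [mulVec, dotProduct, Fin.sum_univ_three, hN.D30, hN.D31, hN.D32] using this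
    obtain ⟨c', hc'⟩ := h.exists_of_isHomogeneous_one (v := ![0, 0, ℓ 1, ℓ 2]) (by
      intro i; fin_cases i
      exacts [isHomogeneous_zero _ _ _, isHomogeneous_zero _ _ _, hℓ 1, hℓ 2]) (by
      simp [dotProduct, Fin.sum_univ_four]
      linear_combination -(ℓ 2) * c2 + ℓ 1 * c3)
    have d2 : ℓ 1 = z * C (c' 1) := by
      have := congrFun hc' 2
      simpa [mulVec, dotProduct, Fin.sum_univ_three, hN.D20, hN.D21, hN.D22] using this
    have d3 : ℓ 2 = z * C (c' 2) := by
      have := congrFun hc' 3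
      simpa [mulVec, dotProduct, Fin.sum_univ_three, hN.D30, hN.D31, hN.D32] using this
    have hc0 := h.q_indep ![0, 0, c' 1, c' 2] (by
      simp [dotProduct, Fin.sum_univ_four]
      rw [d2] at c2
      rw [d3] at c3
      linear_combination C (c' 1) * c3 - C (c' 2) * c2)
    have hc2 : c' 2 = 0 := by simpa using congrFun hc0 3
    rw [hc2, C_0, mul_zero] at d3
    exact h.q_ne_zero 2 (by rw [c3, d3, mul_zero])
  have hCc : (C c⁻¹ * C c : MvPolynomial (Fin n) k) = 1 := by
    rw [← C_mul, inv_mul_cancel₀ hc0, C_1]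
  obtain ⟨e, s, rfl⟩ := (h.exact v).1 hv
  refine ⟨e - (s * C c⁻¹) • ℓ, s * C c⁻¹, ?_⟩
  rw [hc, mulVec_sub, mulVec_smul, smul_add, smul_smul, mul_assoc, hCc, mul_one]
  abel

theorem NormalForm.isLGQuadratic (h : QuadricSyzygies q D κ) (hN : NormalForm q D z)
    (hz : z.IsHomogeneous 1) : IsLGQuadratic (Ideal.span (Set.range q)) := by
  obtain ⟨x, y, t, hx, hy, ht, q0, q1, D00, D10, q2, q3⟩ := hN.exists_eq h hz
  have f2 : q 2 = -D 0 1 * x + -D 1 1 * y := by rw [q2]; ring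
  have f3 : q 3 = -D 0 2 * x + -D 1 2 * y := by rw [q3]; ring
  have hspan : Ideal.span (Set.range q) =
      Ideal.span {x * z, y * z, -D 0 1 * x + -D 1 1 * y, -D 0 2 * x + -D 1 2 * y} := by
    rw [← f2, ← f3, ← q0, ← q1]
    congr 1
    ext p
    simp [Fin.exists_fin_succ, eq_comm]
  rw [hspan]
  have hx0 : x ≠ 0 := by rintro rfl; exact h.q_ne_zero 0 (by rw [q0, zero_mul])
  have hxy : ¬ x ∣ y := by
    intro hd
    obtain ⟨t, ht⟩ := exists_eq_C_mul_of_dvd hy hx hd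
    have := h.q_indep ![-t, 1, 0, 0] (by
      simp [dotProduct, Fin.sum_univ_four, q0, q1, ht]; ring)
    simpa using congrFun this 1
  have hrel : IsRelPrime x y :=
    ((prime_of_isHomogeneous_one hx hx0).irreducible.isRelPrime_iff_not_dvd).2 hxy
  -- Pairing the first two rows with `(x, y)` kills the column `(t y, -t x)` and turns the other two
  -- columns into `-q 2` and `-q 3`.
  have key : ∀ v0 v1 v2 v3, v0 * q 0 + v1 * q 1 + v2 * q 2 + v3 * q 3 = 0 →
      ∃ e1 e2 s, x * v0 + y * v1 = -(q 2 * e1 + q 3 * e2) ∧ v2 = z * e1 - s * q 3 ∧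
        v3 = z * e2 + s * q 2 := by
    intro v0 v1 v2 v3 hv
    obtain ⟨e, s, hes⟩ := hN.exists_koszul h (v := ![v0, v1, v2, v3]) (by
      simpa [dotProduct, Fin.sum_univ_four] using hv)
    have r0 := congrFun hes 0
    have r1 := congrFun hes 1
    have r2 := congrFun hes 2
    have r3 := congrFun hes 3
    simp [mulVec, dotProduct, Fin.sum_univ_three, hN.D20, hN.D21, hN.D22, hN.D30, hN.D31,
      hN.D32, D00, D10] at r0 r1 r2 r3
    exact ⟨e 1, e 2, s, by rw [q2, q3, r0, r1]; ring, by rw [r2]; ring, r3⟩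
  refine isLGQuadratic_of_linkedMod (h.D_hom 0 1).neg (h.D_hom 1 1).neg (h.D_hom 0 2).neg
    (h.D_hom 1 2).neg hx hy hz ?_
  rw [← f2, ← f3]
  refine ⟨hrel.pairRegularMod hx0, ⟨fun s hs => ?_, ?_⟩, ?_⟩
  · exact (mul_eq_zero.1 ((Ideal.mem_bot).1 hs)).resolve_left (h.q_ne_zero 2)
  · have hgr : IsGraded (⊥ ⊔ Ideal.span {q 2}) :=
      isGraded_bot.sup_span (by simpa using ⟨2, h.q_hom 2⟩)
    -- An element `f` of `(q 2) : q 3` equals `-z e2` modulo `q 2`, and `-e2` lies in this colon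
    -- ideal again.
    have := graded_nakayama (T := {f | q 3 * f ∈ ⊥ ⊔ Ideal.span {q 2}}) hz hgr ?_
    · exact fun f hf => this f hf
    · intro f hf
      simp only [bot_sup_eq, Set.mem_ofPred_eq] at hf ⊢
      obtain ⟨g, hg⟩ := Ideal.mem_span_singleton'.1 hf
      obtain ⟨e1, e2, s, h1, h2, h3⟩ := key 0 0 g (-f) (by linear_combination hg)
      refine ⟨-e2, Ideal.mem_span_singleton'.2 ⟨e1, by linear_combination h1⟩,
        Ideal.mem_span_singleton'.2 ⟨-s, by linear_combination h3⟩⟩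
  · intro p hp hzp
    simp only [bot_sup_eq] at hp hzp ⊢
    obtain ⟨v0, v1, rfl⟩ := Ideal.mem_span_pair.1 hp
    obtain ⟨a, b, hab⟩ := Ideal.mem_span_pair.1 hzp
    obtain ⟨e1, e2, s, h1, -, -⟩ := key v0 v1 (-a) (-b) (by
      rw [q0, q1]; linear_combination -hab)
    exact Ideal.mem_span_pair.2 ⟨-e1, -e2, by linear_combination -h1⟩

theorem isLGQuadratic (h : QuadricSyzygies q D κ) (hs : SecondSyzygy D κ u z) :
    IsLGQuadratic (Ideal.span (Set.range q)) := by
  obtain ⟨P, P', hP, hP', hdvd⟩ := h.exists_row_change hs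
  have h' := h.row_change hP hP'
  obtain ⟨Q, Q', hQ, hQ', hN⟩ := h'.exists_col_change hs.z_hom hdvd
  rw [← span_row_change (q := q) hP']
  exact hN.isLGQuadratic (h'.col_change hQ hQ') hs.z_hom

end QuadricSyzygies

end Syzygies

/-! ### From the Betti table to the syzygy matrices -/

section Resolution

open Matrix

/-- Exactness survives reindexing, so the bases of the resolution can be listed with their degrees
in a fixed order. -/
lemma exact_submatrix {R l m o l' m' o' : Type*} [CommRing R] [Fintype m] [Fintype o]
    [Fintype m'] [Fintype o'] {M : Matrix l m R} {N : Matrix m o R}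
    (h : ∀ v, M *ᵥ v = 0 ↔ ∃ w, N *ᵥ w = v) (e : l' ≃ l) (f : m' ≃ m) (g : o' ≃ o)
    (v : m' → R) : M.submatrix e f *ᵥ v = 0 ↔ ∃ w, N.submatrix f g *ᵥ w = v := by
  have h0 : M.submatrix e f *ᵥ v = 0 ↔ M *ᵥ (v ∘ f.symm) = 0 := by
    rw [submatrix_mulVec_equiv, ← e.surjective.injective_comp_right.eq_iff]
    rfl
  rw [h0, h]
  constructor
  · rintro ⟨w, hw⟩
    refine ⟨w ∘ g, ?_⟩
    rw [submatrix_mulVec_equiv, Function.comp_assoc, g.self_comp_symm, Function.comp_id, hw,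
      Function.comp_assoc, f.symm_comp_self, Function.comp_id]
  · rintro ⟨w, rfl⟩
    refine ⟨w ∘ g.symm, ?_⟩
    rw [submatrix_mulVec_equiv, Function.comp_assoc, f.self_comp_symm, Function.comp_id]

variable {k : Type*} [Field k] {n : ℕ} {I : Ideal (MvPolynomial (Fin n) k)}

namespace MinimalGradedFreeResolution

lemma exists_equiv (F : MinimalGradedFreeResolution I) (i : ℕ) {r : ℕ} (target : Fin r → ℕ)
    (h : ∀ j, Fintype.card {a // target a = j} = F.betti i j) :
    ∃ e : Fin r ≃ Fin (F.rank i), ∀ a, F.deg i (e a) = target a :=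
  ⟨Equiv.ofFiberEquiv fun j => Fintype.equivOfCardEq (h j),
    fun a => Equiv.ofFiberEquiv_map _ a⟩

lemma d_isHomogeneous (F : MinimalGradedFreeResolution I) {i m : ℕ} {a : Fin (F.rank i)}
    {b : Fin (F.rank (i + 1))} (h : F.deg (i + 1) b = F.deg i a + m) :
    (F.d i a b).IsHomogeneous m := by
  by_cases h0 : F.d i a b = 0
  · rw [h0]; exact isHomogeneous_zero _ _ _
  · have := (F.d_homogeneous i a b h0).2
    rwa [h, Nat.add_sub_cancel_left] at this

lemma mulVec_ne_one (F : MinimalGradedFreeResolution I) (i : ℕ) (a : Fin (F.rank i))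
    (w : Fin (F.rank (i + 1)) → MvPolynomial (Fin n) k) : (F.d i *ᵥ w) a ≠ 1 := by
  intro h
  have := congrArg constantCoeff h
  simp [mulVec, dotProduct, F.minimal] at this

end MinimalGradedFreeResolution

/-- An ideal with these graded Betti numbers is generated by quadrics whose first and second
syzygies are given by matrices of the expected shape. -/
theorem exists_quadricSyzygies (h : HasGradedBettiNumbers I bettiTableIII) :
    ∃ q D κ u z, QuadricSyzygies q D κ ∧ SecondSyzygy D κ u z ∧ I = Ideal.span (Set.range q) := by
  obtain ⟨F, hF⟩ := h
  obtain ⟨e0, he0⟩ := F.exists_equiv 0 (r := 1) ![0] fun j => by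
    rw [hF]; rcases j with _ | _ | _ | _ | _ | _ | j <;> rfl
  obtain ⟨e1, he1⟩ := F.exists_equiv 1 (r := 4) ![2, 2, 2, 2] fun j => by
    rw [hF]; rcases j with _ | _ | _ | _ | _ | _ | j <;> rfl
  obtain ⟨e2, he2⟩ := F.exists_equiv 2 (r := 4) ![3, 3, 3, 4] fun j => by
    rw [hF]; rcases j with _ | _ | _ | _ | _ | _ | j <;> rfl
  obtain ⟨e3, he3⟩ := F.exists_equiv 3 (r := 1) ![5] fun j => by
    rw [hF]; rcases j with _ | _ | _ | _ | _ | _ | j <;> rfl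
  obtain ⟨e4, -⟩ := F.exists_equiv 4 (r := 0) ![] fun j => by
    rw [hF]; rcases j with _ | _ | _ | _ | _ | _ | j <;> rfl
  have ex0 := exact_submatrix (F.exact_succ 0) e0 e1 e2
  have ex1 := exact_submatrix (F.exact_succ 1) e1 e2 e3
  have ex2 := exact_submatrix (F.exact_succ 2) e2 e3 e4
  -- the generator of the free module of rank one is a unit
  obtain ⟨c, hc⟩ : ∃ c, F.gen (e0 0) = C c := by
    have := F.gen_homogeneous (e0 0)
    rw [he0] at this
    exact ⟨_, totalDegree_eq_zero_iff_eq_C.1 ((totalDegree_zero_iff_isHomogeneous _).2 this)⟩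
  have hI0 : ∀ f, f * C c ∈ I ↔ ∃ w, ((F.d 0).submatrix e0 e1 *ᵥ w) 0 = f := by
    intro f
    have h := F.exact_zero fun _ => f
    rw [← e0.sum_comp, Fin.sum_univ_one, hc] at h
    rw [h]
    constructor
    · rintro ⟨w, hw⟩
      refine ⟨w ∘ e1, ?_⟩
      rw [submatrix_mulVec_equiv, Function.comp_assoc, e1.self_comp_symm, Function.comp_id, hw]
      rfl
    · rintro ⟨w, hw⟩
      refine ⟨w ∘ e1.symm, ?_⟩
      rw [submatrix_mulVec_equiv] at hw
      funext a
      obtain ⟨a, rfl⟩ := e0.surjective a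
      rwa [Subsingleton.elim a 0]
  -- If `c = 0`, then `1` would lie in the image of the first differential, against minimality.
  have hc0 : c ≠ 0 := by
    rintro rfl
    obtain ⟨w, hw⟩ := (hI0 1).1 (by simp)
    rw [submatrix_mulVec_equiv] at hw
    exact F.mulVec_ne_one 0 _ _ hw
  have hI : ∀ f, f ∈ I ↔ ∃ w, ((F.d 0).submatrix e0 e1 *ᵥ w) 0 = f := fun f => by
    rw [← hI0, mul_comm, Ideal.unit_mul_mem_iff_mem _ (hc0.isUnit.map C)]
  have e4' : IsEmpty (Fin (F.rank 4)) := e4.symm.isEmpty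
  have hA0 : ∀ v, ((F.d 0).submatrix e0 e1 *ᵥ v) 0 = v ⬝ᵥ fun i => F.d 0 (e0 0) (e1 i) :=
    fun v => dotProduct_comm _ _
  have hA1 : ∀ v, (F.d 1).submatrix e1 e2 *ᵥ v =
      (of fun i (j : Fin 3) => F.d 1 (e1 i) (e2 j.castSucc)) *ᵥ (fun j => v j.castSucc) +
        v (Fin.last 3) • fun i => F.d 1 (e1 i) (e2 (Fin.last 3)) := by
    intro v
    funext i
    simp only [mulVec, dotProduct, Fin.sum_univ_castSucc (n := 3), Pi.add_apply, Pi.smul_apply,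
      smul_eq_mul, submatrix_apply, of_apply, mul_comm]
  have hA2 : ∀ s i, ((F.d 2).submatrix e2 e3 *ᵥ s) i = s 0 * F.d 2 (e2 i) (e3 0) := by
    intro s i
    simp [mulVec, dotProduct, mul_comm]
  have hrel : ∀ (e : Fin 3 → MvPolynomial (Fin n) k) (t : MvPolynomial (Fin n) k),
      (of fun i (j : Fin 3) => F.d 1 (e1 i) (e2 j.castSucc)) *ᵥ e +
        t • (fun i => F.d 1 (e1 i) (e2 (Fin.last 3))) = 0 ↔
      ∃ s, e = s • (fun j => F.d 2 (e2 j.castSucc) (e3 0)) ∧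
        t = s * F.d 2 (e2 (Fin.last 3)) (e3 0) := by
    intro e t
    have h := ex1 (Fin.snoc e t)
    simp only [hA1, Fin.snoc_castSucc, Fin.snoc_last] at h
    rw [h]
    constructor
    · rintro ⟨s, hs⟩
      refine ⟨s 0, ?_, ?_⟩
      · funext j
        simpa [hA2] using (congrFun hs j.castSucc).symm
      · rw [← hA2, hs, Fin.snoc_last]
    · rintro ⟨s, rfl, rfl⟩
      refine ⟨fun _ => s, ?_⟩
      funext i
      rw [hA2]
      refine Fin.lastCases ?_ (fun j => ?_) i
      · rw [Fin.snoc_last]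
      · rw [Fin.snoc_castSucc]; rfl
  refine ⟨fun i => F.d 0 (e0 0) (e1 i), of fun i j => F.d 1 (e1 i) (e2 j.castSucc),
    fun i => F.d 1 (e1 i) (e2 (Fin.last 3)), fun j => F.d 2 (e2 j.castSucc) (e3 0),
    F.d 2 (e2 (Fin.last 3)) (e3 0), ⟨?_, ?_, ?_, ?_, ?_⟩,
    ⟨?_, ?_, ?_, fun e t => (hrel e t).1, ?_⟩, ?_⟩
  · intro i
    refine F.d_isHomogeneous ?_
    rw [he0, he1]; fin_cases i <;> rfl
  · intro i j
    refine F.d_isHomogeneous ?_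
    rw [he1, he2]; fin_cases i <;> fin_cases j <;> rfl
  · intro i
    refine F.d_isHomogeneous ?_
    rw [he1, he2]; fin_cases i <;> rfl
  · intro v
    have h0 : v ⬝ᵥ (fun i => F.d 0 (e0 0) (e1 i)) = 0 ↔ (F.d 0).submatrix e0 e1 *ᵥ v = 0 := by
      rw [← hA0, funext_iff, Unique.forall_iff]
      rfl
    rw [h0, ex0]
    constructor
    · rintro ⟨w, rfl⟩
      exact ⟨_, _, hA1 w⟩
    · rintro ⟨e, t, rfl⟩
      exact ⟨Fin.snoc e t, by simp only [hA1, Fin.snoc_castSucc, Fin.snoc_last]⟩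
  · intro c h
    obtain ⟨s, hs, -⟩ := (hrel _ 0).1 (by rw [zero_smul, add_zero, h])
    funext j
    have := congrArg constantCoeff (congrFun hs j)
    simpa [F.minimal] using this
  · intro j
    refine F.d_isHomogeneous ?_
    rw [he2, he3]; fin_cases j <;> rfl
  · refine F.d_isHomogeneous ?_
    rw [he2, he3]; rfl
  · exact (hrel _ _).2 ⟨1, (one_smul _ _).symm, (one_mul _).symm⟩
  -- A zero last map would have the constant `1` in its kernel, which is the image of a free module
  -- of rank zero.
  · by_contra! hz
    obtain ⟨w, hw⟩ := (ex2 fun _ => 1).1 (by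
      funext i
      rw [hA2, one_mul]
      refine Fin.lastCases hz.2 (fun j => congrFun hz.1 j) i)
    simpa [mulVec, dotProduct] using congrFun hw 0
  · ext f
    rw [hI, Ideal.mem_span_range_iff_exists_fun]
    simp only [hA0, dotProduct]

end Resolution

theorem corollary3p5 {k : Type*} [Field k] [IsAlgClosed k] {n : ℕ}
    (I : Ideal (MvPolynomial (Fin n) k))
    (hI : HasGradedBettiNumbers I bettiTableIII ∨ HasFormIII I) :
    IsLGQuadratic I := by
  rcases hI with hI | hI
  · obtain ⟨q, D, κ, u, z, h, hs, rfl⟩ := exists_quadricSyzygies hI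
    exact h.isLGQuadratic hs
  · exact isLGQuadratic_of_hasFormIII hI
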